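/- An *entire algebraic function* of $N$ complex variables is a multivalued function $y$ on $\mathbb C^N$ defined by an equation $y^n+f_{n-1}y^{n-1}+\dots+f_0=0$, $n\ge 1$, with polynomial coefficients $f_i\in\mathbb C[x_1,\dots,x_N]$, which is irreducible over $\mathbb C(x_1,\dots,x_N)$. Let $\Sigma\subset\mathbb C^N$ be the zero set of the discriminant of this equation. For an open set $U\subset\mathbb C^N$ and $x_0\in U\setminus\Sigma$, the monodromy group of $y$ over $U$ at $x_0$ is the image of $\pi_1(U\setminus\Sigma,x_0)$ in the group of permutations of the $n$ roots of the equation at $x_0$, a loop acting by continuation of the roots along it. The *local monodromy group* of $y$ at $p\in\mathbb C^N$ is the monodromy group over an arbitrarily small ball around $p$; it is said to have a property if, for all sufficiently small $\varepsilon>0$, the monodromy group over the ball of radius $\varepsilon$ about $p$ (in the maximum norm) has that property at every base point. Let $\Phi$ be an entire algebraic function of $k$ variables and $G_1,\dots,G_k,H$ entire algebraic functions of $N$ variables. We say that $H$ is representable as the composition $\Phi(G_1,\dots,G_k)$ if over some nonempty open set $V\subset\mathbb C^N$ there are single-valued analytic branches $g_i$ of $G_i$ and $h$ of $H$ such that $h(x)$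 is one of the values of $\Phi$ at $(g_1(x),\dots,g_k(x))$ for every $x\in V$. Given a list $B$ of basic functions, a function of $N$ variables is *expressible* through $B$ if it is obtained from the coordinate functions $x_1,\dots,x_N$ by finitely many compositions whose outer function $\Phi$ is in $B$. **Theorem.** (i) Let $y$ be an entire algebraic function of $N$ variables that is expressible as a composition of polynomials (of any number of variables) and entire algebraic functions of one variable. Then the local monodromy group of $y$ at every point $p\in\mathbb C^N$ is solvable. (ii) The local monodromy group at the origin of the entire algebraic function $y(a,b)$ of two variables defined by $y^5+ay+b=0$ is the full symmetric group $S_5$ of permutations of its five values. (iii) Consequently $y(a,b)$ cannot be expressed in terms of entire algebraic functions of one variable by means of composition, addition and multiplication; that is, it is not expressible through the list consisting of the addition $u+v$, the multiplication $uv$ and all entire algebraic functions of one variable. -/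

import Mathlib

/-- An entire algebraic function of `N` complex variables: the multivalued function `y` on `ℂ^N`
defined by an irreducible equation `y ^ n + f_{n-1} y ^ (n-1) + ⋯ + f_0 = 0` with polynomial
coefficients `f_i ∈ ℂ[x_1, …, x_N]`. -/
structure EntireAlgFun (N : ℕ) where
  eqn : Polynomial (MvPolynomial (Fin N) ℂ)
  monic : eqn.Monic
  irreducible : Irreducible eqn

namespace EntireAlgFun

variable {N : ℕ} (F : EntireAlgFun N)

/-- The defining polynomial in `y`, with its coefficients evaluated at the point `x`. -/
noncomputable def eqnAt (x : Fin N → ℂ) : Polynomial ℂ := F.eqn.map (MvPolynomial.eval x)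

/-- The set of values of the multivalued function at the point `x`. -/
def values (x : Fin N → ℂ) : Set ℂ := {v | (F.eqnAt x).eval v = 0}

/-- The graph `{(x, v) | v is a value at x}` of the multivalued function. -/
def graph : Set ((Fin N → ℂ) × ℂ) := {q | q.2 ∈ F.values q.1}

/-- The projection of the graph to `ℂ^N`. -/
def proj : F.graph → (Fin N → ℂ) := fun q => q.1.1

/-- The complement of the discriminant hypersurface of the defining equation. -/
def regularSet : Set (Fin N → ℂ) := {x | MvPolynomial.eval x F.eqn.discr ≠ 0}

theorem eqnAt_monic (x : Fin N → ℂ) : (F.eqnAt x).Monic := F.monic.map _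

theorem natDegree_pos : 0 < F.eqn.natDegree := by
  rcases Nat.eq_zero_or_pos F.eqn.natDegree with h | h
  · exact absurd (F.monic.natDegree_eq_zero.mp h ▸ isUnit_one) F.irreducible.not_isUnit
  · exact h

theorem eval_eqnAt (x : Fin N → ℂ) (v : ℂ) : (F.eqnAt x).eval v =
    ∑ i ∈ Finset.range (F.eqn.natDegree + 1), MvPolynomial.eval x (F.eqn.coeff i) * v ^ i := by
  rw [eqnAt, Polynomial.eval_map, Polynomial.eval₂_eq_sum_range]

/-- Over the complement of the discriminant hypersurface all roots are simple. -/
theorem derivative_ne_zero {x : Fin N → ℂ} (hx : x ∈ F.regularSet) {v : ℂ}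
    (hv : v ∈ F.values x) : (F.eqnAt x).derivative.eval v ≠ 0 := by
  intro hd
  have h1 := Polynomial.resultant_deriv (Polynomial.natDegree_pos_iff_degree_pos.mp F.natDegree_pos)
  rw [F.monic.leadingCoeff, mul_one] at h1
  have h2 := congrArg (MvPolynomial.eval x) h1
  rw [← Polynomial.resultant_map_map, ← Polynomial.derivative_map] at h2
  have hdeg : (F.eqnAt x).natDegree = F.eqn.natDegree := F.monic.natDegree_map _
  have hdeg' : (F.eqnAt x).derivative.natDegree = F.eqn.natDegree - 1 := by
    rw [Polynomial.natDegree_derivative, hdeg]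
  have h3 : Polynomial.resultant (F.eqnAt x) (F.eqnAt x).derivative ≠ 0 := by
    rw [hdeg, hdeg']
    change Polynomial.resultant (F.eqnAt x) (F.eqnAt x).derivative _ _ = _ at h2
    rw [h2, map_mul]
    exact mul_ne_zero (by simp) hx
  refine h3 (Polynomial.resultant_eq_zero_iff.mpr ⟨Or.inl (F.eqnAt_monic x).ne_zero, ?_⟩)
  rintro ⟨a, b, hab⟩
  have h4 := congrArg (Polynomial.eval v) hab
  have hv' : (F.eqnAt x).eval v = 0 := hv
  simp [hd, hv'] at h4

theorem analyticAt_eval (q : (Fin N → ℂ) × ℂ) :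
    AnalyticAt ℂ (fun q : (Fin N → ℂ) × ℂ => (F.eqnAt q.1).eval q.2) q := by
  simp only [eval_eqnAt]
  refine Finset.analyticAt_fun_sum _ fun i _ => ?_
  refine AnalyticAt.mul ?_ (analyticAt_snd.pow i)
  have := AnalyticAt.aeval_mvPolynomial (𝕜 := ℂ) (f := fun q : (Fin N → ℂ) × ℂ => q.1) (z := q)
    (fun i => ((ContinuousLinearMap.proj (R := ℂ) (φ := fun _ : Fin N => ℂ) i).comp
      (ContinuousLinearMap.fst ℂ (Fin N → ℂ) ℂ)).analyticAt q) (F.eqn.coeff i)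
  simpa [MvPolynomial.aeval_eq_eval] using this

theorem continuous_eval :
    Continuous (fun q : (Fin N → ℂ) × ℂ => (F.eqnAt q.1).eval q.2) :=
  continuous_iff_continuousAt.mpr fun q => (F.analyticAt_eval q).continuousAt

theorem continuous_proj : Continuous F.proj := continuous_fst.comp continuous_subtype_val

theorem isClosed_graph : IsClosed F.graph := isClosed_singleton.preimage F.continuous_eval

theorem isClosedMap_proj : IsClosedMap F.proj := by
  refine IsProperMap.isClosedMap
    (isProperMap_iff_isCompact_preimage.mpr ⟨F.continuous_proj, fun K hK => ?_⟩)
  have hbound : ∃ R : ℝ, ∀ x ∈ K, ∀ v ∈ F.values x, ‖v‖ ≤ R := by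
    have hc : Continuous fun x : Fin N → ℂ =>
        ∑ i ∈ Finset.range F.eqn.natDegree, ‖MvPolynomial.eval x (F.eqn.coeff i)‖ :=
      continuous_finsetSum _ fun i _ => (MvPolynomial.continuous_eval _).norm
    obtain ⟨R, hR⟩ := hK.bddAbove_image hc.continuousOn
    refine ⟨R + 1, fun x hx v hv => ?_⟩
    have h1 := Polynomial.IsRoot.norm_lt_cauchyBound (F.eqnAt_monic x).ne_zero (a := v) hv
    have h2 : ((F.eqnAt x).cauchyBound : ℝ) ≤ R + 1 := by
      rw [Polynomial.cauchyBound, (F.eqnAt_monic x).leadingCoeff]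
      have h3 : ((Finset.range (F.eqnAt x).natDegree).sup fun i => ‖(F.eqnAt x).coeff i‖₊) ≤
          ∑ i ∈ Finset.range (F.eqnAt x).natDegree, ‖(F.eqnAt x).coeff i‖₊ :=
        Finset.sup_le fun i hi =>
          Finset.single_le_sum (f := fun i => ‖(F.eqnAt x).coeff i‖₊) (fun _ _ => zero_le) hi
      have h4 := hR (Set.mem_image_of_mem _ hx)
      have h5 : ((∑ i ∈ Finset.range (F.eqnAt x).natDegree, ‖(F.eqnAt x).coeff i‖₊ : NNReal) : ℝ)
          ≤ R := by
        rw [show (F.eqnAt x).natDegree = F.eqn.natDegree from F.monic.natDegree_map _]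
        simpa [eqnAt] using h4
      have h6 : (((Finset.range (F.eqnAt x).natDegree).sup
          fun i => ‖(F.eqnAt x).coeff i‖₊ : NNReal) : ℝ) ≤ R := (NNReal.coe_le_coe.mpr h3).trans h5
      simpa using h6
    exact (NNReal.coe_lt_coe.mpr h1).le.trans h2
  obtain ⟨R, hR⟩ := hbound
  rw [Topology.IsEmbedding.subtypeVal.isCompact_iff]
  refine (hK.prod (isCompact_closedBall (0 : ℂ) R)).of_isClosed_subset ?_ ?_
  · exact F.isClosed_graph.isClosedMap_subtype_val _ (hK.isClosed.preimage F.continuous_proj)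
  · rintro _ ⟨q, hq, rfl⟩
    exact ⟨hq, by simpa using hR _ hq _ q.2⟩

theorem finite_fiber (x : Fin N → ℂ) : (F.proj ⁻¹' {x}).Finite := by
  have h1 : (F.values x).Finite := by
    refine (F.eqnAt x).roots.toFinset.finite_toSet.subset fun v hv => ?_
    have hv' : (F.eqnAt x).IsRoot v := hv
    simpa [(F.eqnAt_monic x).ne_zero] using hv'
  refine Set.Finite.of_finite_image (f := fun q : F.graph => q.1.2) (h1.subset ?_) ?_
  · rintro _ ⟨q, hq, rfl⟩
    have hq' : q.1.1 = x := hq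
    exact hq' ▸ q.2
  · intro q hq q' hq' h
    exact Subtype.ext (Prod.ext ((show q.1.1 = x from hq).trans (show q'.1.1 = x from hq').symm) h)

/-- Near a simple root the projection of the graph is a local homeomorphism. -/
theorem isLocalHomeomorphOn_proj : IsLocalHomeomorphOn F.proj (F.proj ⁻¹' F.regularSet) := by
  refine IsLocalHomeomorphOn.mk _ _ fun q₀ hq₀ => ?_
  let f : (Fin N → ℂ) × ℂ → ℂ := fun q => (F.eqnAt q.1).eval q.2
  have hf : HasStrictFDerivAt f (fderiv ℂ f q₀.1) q₀.1 := (F.analyticAt_eval q₀.1).hasStrictFDerivAt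
  set f' := fderiv ℂ f q₀.1 with hf'
  have hc : f' (0, 1) ≠ 0 := by
    have h1 : HasDerivAt (fun v : ℂ => (q₀.1.1, v)) (0, 1) q₀.1.2 :=
      (hasDerivAt_const _ _).prodMk (hasDerivAt_id _)
    have h2 := HasFDerivAt.comp_hasDerivAt (x := q₀.1.2) (f := fun v : ℂ => (q₀.1.1, v))
      (l := f) (l' := f') hf.hasFDerivAt h1
    have h3 := ((F.eqnAt q₀.1.1).hasDerivAt q₀.1.2).unique h2
    rw [← h3]
    exact F.derivative_ne_zero hq₀ q₀.2
  have hsplit : ∀ a b, f' (a, b) = f' (a, 0) + b * f' (0, 1) := fun a b => by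
    have : (a, b) = (a, (0 : ℂ)) + b • ((0 : Fin N → ℂ), (1 : ℂ)) := by simp
    rw [this, map_add, map_smul, smul_eq_mul]
  let L := (ContinuousLinearMap.fst ℂ (Fin N → ℂ) ℂ).prod f'
  have hinj : Function.Injective L := by
    rw [injective_iff_map_eq_zero]
    rintro ⟨a, b⟩ h
    obtain ⟨rfl, h2⟩ : a = 0 ∧ f' (a, b) = 0 := by simpa [L] using h
    rw [hsplit] at h2
    have h4 : f' ((0 : Fin N → ℂ), (0 : ℂ)) = 0 := map_zero f'
    rw [h4, zero_add] at h2
    simp [(mul_eq_zero.mp h2).resolve_right hc]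
  have hsurj : Function.Surjective L := by
    rintro ⟨a, b⟩
    refine ⟨(a, (b - f' (a, 0)) / f' (0, 1)), Prod.ext rfl ?_⟩
    change f' _ = b
    rw [hsplit, div_mul_cancel₀ _ hc]
    ring
  let L' := ContinuousLinearEquiv.ofBijective L (LinearMap.ker_eq_bot.mpr hinj)
    (LinearMap.range_eq_top.mpr hsurj)
  have hΨ : HasStrictFDerivAt (fun q : (Fin N → ℂ) × ℂ => (q.1, f q))
      (L' : (Fin N → ℂ) × ℂ →L[ℂ] (Fin N → ℂ) × ℂ) q₀.1 := by
    have : (L' : (Fin N → ℂ) × ℂ →L[ℂ] (Fin N → ℂ) × ℂ) = L := by ext <;> rfl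
    rw [this]
    exact hasStrictFDerivAt_fst.prodMk hf
  let e := hΨ.toOpenPartialHomeomorph _
  have he : ∀ q, e q = (q.1, f q) := fun q => rfl
  have hmem : ∀ x, (x, (0 : ℂ)) ∈ e.target → e.symm (x, 0) ∈ F.graph ∧ (e.symm (x, 0)).1 = x := by
    intro x hx
    have h1 := e.right_inv hx
    rw [he] at h1
    exact ⟨congrArg Prod.snd h1, congrArg Prod.fst h1⟩
  have hgr : ∀ q : F.graph, e q.1 = (F.proj q, 0) := fun q => Prod.ext rfl q.2
  classical
  let g : (Fin N → ℂ) → F.graph := fun x =>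
    if h : e.symm (x, 0) ∈ F.graph then ⟨_, h⟩ else q₀
  have hg : ∀ x, (x, (0 : ℂ)) ∈ e.target → (g x).1 = e.symm (x, 0) := fun x hx => by
    simp only [g, dif_pos (hmem x hx).1]
  have hcont : Continuous fun x : Fin N → ℂ => (x, (0 : ℂ)) := by fun_prop
  refine ⟨{ toFun := F.proj
            invFun := g
            source := {q | q.1 ∈ e.source}
            target := {x | (x, (0 : ℂ)) ∈ e.target}
            map_source' := fun q hq => by
              have := e.map_source hq
              rwa [hgr] at this
            map_target' := fun x hx => by
              change (g x).1 ∈ e.source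
              rw [hg x hx]
              exact e.map_target hx
            left_inv' := fun q hq => by
              have h1 := e.map_source hq
              rw [hgr] at h1
              refine Subtype.ext ?_
              rw [hg _ h1, ← hgr, e.left_inv hq]
            right_inv' := fun x hx => by
              change (g x).1.1 = x
              rw [hg x hx]
              exact (hmem x hx).2
            open_source := e.open_source.preimage continuous_subtype_val
            open_target := e.open_target.preimage hcont
            continuousOn_toFun := F.continuous_proj.continuousOn
            continuousOn_invFun := by
              rw [Topology.IsInducing.subtypeVal.continuousOn_iff]
              exact (e.continuousOn_symm.comp hcont.continuousOn fun x hx => hx).congr hg },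
    hΨ.mem_toOpenPartialHomeomorph_source, fun _ _ => rfl⟩

/-- Off the discriminant hypersurface the graph is a (finite) covering. -/
theorem isCoveringMapOn_proj : IsCoveringMapOn F.proj F.regularSet :=
  F.isClosedMap_proj.isCoveringMapOn_of_isLocalHomeomorphOn (fun x _ => F.finite_fiber x)
    F.isLocalHomeomorphOn_proj

/-- The domain `U` with the discriminant hypersurface removed. -/
def regularIn (U : Set (Fin N → ℂ)) : Set (Fin N → ℂ) := U ∩ F.regularSet

/-- The part of the graph over `U` minus the discriminant hypersurface, as a space over it. -/
def projIn (U : Set (Fin N → ℂ)) : F.proj ⁻¹' F.regularIn U → F.regularIn U :=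
  (F.regularIn U).restrictPreimage F.proj

theorem isCoveringMap_projIn (U : Set (Fin N → ℂ)) : IsCoveringMap (F.projIn U) :=
  (F.isCoveringMapOn_proj.mono Set.inter_subset_right).isCoveringMap_restrictPreimage

/-- The monodromy group of the defining equation over the domain `U`, with base point `x₀`: the
image of the fundamental group of `U` minus the discriminant hypersurface in the group of
permutations of the roots at `x₀`, a loop acting by continuation of the roots along it. (The roots
at `x₀` are simple, so they correspond to the germs at `x₀` of solutions of the equation.) -/
noncomputable def monodromyGroup (U : Set (Fin N → ℂ)) (x₀ : F.regularIn U) :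
    Subgroup (Equiv.Perm (F.projIn U ⁻¹' {x₀})) :=
  ((F.isCoveringMap_projIn U).monodromyPerm x₀).range

/-- The local monodromy group at `p`, i.e. the monodromy group over an arbitrarily small
neighbourhood of `p`, is solvable. -/
def HasSolvableLocalMonodromyAt (p : Fin N → ℂ) : Prop :=
  ∀ᶠ ε in nhdsWithin (0 : ℝ) (Set.Ioi 0), ∀ x₀ : F.regularIn (Metric.ball p ε),
    Group.IsSolvable (F.monodromyGroup (Metric.ball p ε) x₀)

/-- The local monodromy group at `p` is the full symmetric group on `n` roots: over an arbitrarily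
small neighbourhood of `p` the equation has `n` roots at each base point, and each permutation of
them is realised by a loop. -/
def HasFullSymmetricLocalMonodromyAt (p : Fin N → ℂ) (n : ℕ) : Prop :=
  ∀ᶠ ε in nhdsWithin (0 : ℝ) (Set.Ioi 0), ∀ x₀ : F.regularIn (Metric.ball p ε),
    Nat.card (F.projIn (Metric.ball p ε) ⁻¹' {x₀}) = n ∧
      F.monodromyGroup (Metric.ball p ε) x₀ = ⊤

/-- `g` is a single-valued analytic branch of the multivalued function over the set `V`. -/
def IsBranchOn (V : Set (Fin N → ℂ)) (g : (Fin N → ℂ) → ℂ) : Prop :=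
  AnalyticOnNhd ℂ g V ∧ ∀ x ∈ V, g x ∈ F.values x

/-- `H` is representable as the composition `Φ(G_1, …, G_k)` of multivalued functions: over some
nonempty open set there are branches `g_i` of `G_i` and a branch `h` of `H` such that `h(x)` is a
value of `Φ` at the point `(g_1(x), …, g_k(x))`. Since `H` is given by an irreducible equation, it
is the multivalued function generated by `h` through analytic continuation. -/
def IsComposition {k : ℕ} (Φ : EntireAlgFun k) (G : Fin k → EntireAlgFun N)
    (H : EntireAlgFun N) : Prop :=
  ∃ V : Set (Fin N → ℂ), IsOpen V ∧ V.Nonempty ∧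
    ∃ (g : Fin k → (Fin N → ℂ) → ℂ) (h : (Fin N → ℂ) → ℂ),
      (∀ i, (G i).IsBranchOn V (g i)) ∧ H.IsBranchOn V h ∧
      ∀ x ∈ V, h x ∈ Φ.values fun i => g i x

/-- A polynomial, as a (single-valued) entire algebraic function. -/
noncomputable def ofPolynomial (P : MvPolynomial (Fin N) ℂ) : EntireAlgFun N where
  eqn := Polynomial.X - Polynomial.C P
  monic := Polynomial.monic_X_sub_C P
  irreducible := Polynomial.irreducible_X_sub_C P

/-- The class of multivalued functions of `N` variables obtained from the coordinate functions
`x_1, …, x_N` by repeated composition with functions from the list `B`. -/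
inductive IsExpressible (B : (k : ℕ) → EntireAlgFun k → Prop) : EntireAlgFun N → Prop
  | coord (i : Fin N) : IsExpressible B (ofPolynomial (MvPolynomial.X i))
  | comp {k : ℕ} (Φ : EntireAlgFun k) (G : Fin k → EntireAlgFun N) (H : EntireAlgFun N)
      (hΦ : B k Φ) (hG : ∀ i, IsExpressible B (G i)) (hH : IsComposition Φ G H) :
      IsExpressible B H

/-- Basic functions: polynomials in any number of variables, and entire algebraic functions of
one variable. -/
inductive IsPolynomialOrOneVariable : (k : ℕ) → EntireAlgFun k → Prop
  | polynomial {k : ℕ} (P : MvPolynomial (Fin k) ℂ) : IsPolynomialOrOneVariable k (ofPolynomial P)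
  | oneVariable (f : EntireAlgFun 1) : IsPolynomialOrOneVariable 1 f

/-- Basic functions: addition and multiplication (as functions of two variables), and entire
algebraic functions of one variable. -/
inductive IsSumOrProductOrOneVariable : (k : ℕ) → EntireAlgFun k → Prop
  | sum : IsSumOrProductOrOneVariable 2
      (ofPolynomial (MvPolynomial.X 0 + MvPolynomial.X 1 : MvPolynomial (Fin 2) ℂ))
  | product : IsSumOrProductOrOneVariable 2
      (ofPolynomial (MvPolynomial.X 0 * MvPolynomial.X 1 : MvPolynomial (Fin 2) ℂ))
  | oneVariable (f : EntireAlgFun 1) : IsSumOrProductOrOneVariable 1 f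

/-- The polynomial `y ^ 5 + a y + b`, where `a = X 0` and `b = X 1`. -/
noncomputable def quinticEqn : Polynomial (MvPolynomial (Fin 2) ℂ) :=
  Polynomial.X ^ 5 + Polynomial.C (MvPolynomial.X 0) * Polynomial.X +
    Polynomial.C (MvPolynomial.X 1)

theorem quinticEqn_natDegree : quinticEqn.natDegree = 5 := by
  unfold quinticEqn
  compute_degree!

theorem quinticEqn_monic : quinticEqn.Monic := by
  unfold quinticEqn
  monicity!

theorem quinticEqn_irreducible : Irreducible quinticEqn := by
  let P : Ideal (MvPolynomial (Fin 2) ℂ) := RingHom.ker MvPolynomial.constantCoeff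
  have hP : ∀ p, p ∈ P ↔ MvPolynomial.constantCoeff p = 0 := fun p => Iff.rfl
  refine Polynomial.irreducible_of_eisenstein_criterion (P := P) (RingHom.ker_isPrime _) ?_ ?_ ?_ ?_
    quinticEqn_monic.isPrimitive
  · rw [quinticEqn_monic.leadingCoeff, hP]
    simp
  · intro n hn
    rw [Polynomial.degree_eq_natDegree quinticEqn_monic.ne_zero, quinticEqn_natDegree] at hn
    have hn' : n < 5 := by exact_mod_cast hn
    rw [hP]
    interval_cases n <;> simp [quinticEqn, Polynomial.coeff_X, Polynomial.coeff_C]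
  · rw [← Polynomial.natDegree_pos_iff_degree_pos, quinticEqn_natDegree]
    norm_num
  · have h0 : quinticEqn.coeff 0 = MvPolynomial.X 1 := by simp [quinticEqn]
    rw [h0]
    intro h
    have key : ∀ p ∈ P ^ 2,
        MvPolynomial.constantCoeff (MvPolynomial.pderiv (1 : Fin 2) p) = 0 := by
      intro p hp
      rw [pow_two] at hp
      refine Submodule.mul_induction_on hp (fun a ha b hb => ?_) fun a b ha hb => ?_
      · rw [hP] at ha hb
        simp [Derivation.leibniz, ha, hb]
      · simp [ha, hb]
    simpa using key _ h

/-- The entire algebraic function `y(a, b)` defined by `y ^ 5 + a y + b = 0`. -/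
noncomputable def quintic : EntireAlgFun 2 where
  eqn := quinticEqn
  monic := quinticEqn_monic
  irreducible := quinticEqn_irreducible

end EntireAlgFun

/-! Solvability is proved by induction over compositions H = Φ(G_1, …, G_k), in terms of loops in a
small ball about p with a hypersurface D = 0 removed. Let K be a group of loops along which every
continuation of every G_i closes up. If Φ is a polynomial, continuation along K already fixes H. If
Φ has one variable, then near p a branch g of G stays close to one of its finitely many values c at
p, and Φ is unramified in a punctured disc about c. There Φ is a single-valued function of the
logarithm, so h is a single-valued function of log(g - c). Along a loop of K this logarithm changes
by a multiple of 2πi; these periods add up and cancel on commutators, so [K, K] fixes H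
(`solvableNear_comp_oneVariable`). Each composition thus costs at most one further step of the
derived series.

Two facts make this rigorous. A composition is given only over some open set, but its branches are
rational functions of one algebraic function; hence, off a hypersurface, continuing a value of H
carries suitable values of the G_i along (`IsComposition.exists_isLift`). And removing a
hypersurface from an open set is harmless, because loops can be pushed off it
(`map_inclusion_surjective`). `SolvableNear` quantifies over all multiples of D so that the
exceptional hypersurfaces of several functions can be merged.

For the quintic, turning b around 0 with a = 0 gives a 5-cycle, and a small loop around a point of
the discriminant curve where just two roots meet gives a transposition. Since 5 is prime, these
generate all permutations, and S_5 is not solvable. -/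

open Topology unitInterval

/-! ### Continuation of values along paths, and monodromy -/

namespace EntireAlgFun

variable {N : ℕ}

/-- A continuous choice `v` of values of the multivalued function along `γ`. -/
def IsLift (F : EntireAlgFun N) (γ : I → Fin N → ℂ) (v : I → ℂ) : Prop :=
  Continuous v ∧ ∀ t, v t ∈ F.values (γ t)

/-- The part of the graph over `X`, as a space over `X`. -/
def projOver (F : EntireAlgFun N) (X : Set (Fin N → ℂ)) : F.proj ⁻¹' X → X :=
  X.restrictPreimage F.proj

section Lifts

variable {F : EntireAlgFun N} {X : Set (Fin N → ℂ)}

theorem isCoveringMap_projOver (hX : X ⊆ F.regularSet) : IsCoveringMap (F.projOver X) :=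
  (F.isCoveringMapOn_proj.mono hX).isCoveringMap_restrictPreimage

/-- The value of the multivalued function at a point of the fibre of the graph. -/
def fiberVal {x : X} (e : F.projOver X ⁻¹' {x}) : ℂ := e.1.1.1.2

theorem fiber_base {x : X} (e : F.projOver X ⁻¹' {x}) : e.1.1.1.1 = x.1 :=
  congrArg Subtype.val (show F.projOver X e.1 = x from e.2)

theorem fiberVal_mem {x : X} (e : F.projOver X ⁻¹' {x}) : fiberVal e ∈ F.values x.1 := by
  rw [← fiber_base e]
  exact e.1.1.2

theorem fiberVal_injective {x : X} :
    Function.Injective (fiberVal : F.projOver X ⁻¹' {x} → ℂ) := fun e e' h =>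
  Subtype.ext (Subtype.ext (Subtype.ext (Prod.ext ((fiber_base e).trans (fiber_base e').symm) h)))

/-- The point of the fibre with a given value. -/
def fiberMk (x : X) {v : ℂ} (hv : v ∈ F.values x.1) : F.projOver X ⁻¹' {x} :=
  ⟨⟨⟨(x.1, v), hv⟩, x.2⟩, rfl⟩

@[simp] theorem fiberVal_fiberMk (x : X) {v : ℂ} (hv : v ∈ F.values x.1) :
    fiberVal (fiberMk x hv) = v := rfl

theorem fiberMk_fiberVal {x : X} (e : F.projOver X ⁻¹' {x}) : fiberMk x (fiberVal_mem e) = e :=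
  fiberVal_injective rfl

/-- The fibre of the graph is the set of values. -/
def fiberEquiv (F : EntireAlgFun N) (x : X) : (F.projOver X ⁻¹' {x}) ≃ F.values x.1 where
  toFun e := ⟨fiberVal e, fiberVal_mem e⟩
  invFun v := fiberMk x v.2
  left_inv e := fiberMk_fiberVal e
  right_inv _ := rfl

theorem exists_isLift_of_path (hX : X ⊆ F.regularSet) (γ : C(I, X)) {v₀ : ℂ}
    (hv : v₀ ∈ F.values (γ 0).1) : ∃ v, F.IsLift (fun t => (γ t).1) v ∧ v 0 = v₀ := by
  have cov := isCoveringMap_projOver hX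
  obtain ⟨Γ, h1, h2⟩ := cov.exists_path_lifts γ (fiberMk (γ 0) hv).1 rfl
  have hb : ∀ t, (Γ t).1.1.1 = (γ t).1 := fun t => congrArg Subtype.val (congrFun h1 t)
  refine ⟨fun t => (Γ t).1.1.2, ⟨by fun_prop, fun t => ?_⟩, ?_⟩
  · change (Γ t).1.1.2 ∈ F.values (γ t).1
    rw [← hb t]
    exact (Γ t).1.2
  · simp only [h2]
    rfl

theorem exists_isLift {γ : I → Fin N → ℂ} (hγ : Continuous γ) (hr : ∀ t, γ t ∈ F.regularSet)
    {v₀ : ℂ} (hv : v₀ ∈ F.values (γ 0)) : ∃ v, F.IsLift γ v ∧ v 0 = v₀ :=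
  exists_isLift_of_path (X := F.regularSet) subset_rfl ⟨fun t => ⟨γ t, hr t⟩, by fun_prop⟩ hv

theorem monodromy_eq (hX : X ⊆ F.regularSet) {x y : X} (γ : Path x y) {v : I → ℂ}
    (hv : F.IsLift (fun t => (γ t).1) v) (e : F.projOver X ⁻¹' {x}) (he : v 0 = fiberVal e) :
    fiberVal ((isCoveringMap_projOver hX).monodromy (.mk γ) e) = v 1 := by
  let Γ : I → F.proj ⁻¹' X := fun t => ⟨⟨((γ t).1, v t), hv.2 t⟩, (γ t).2⟩
  have hc : Continuous Γ := by
    have := hv.1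
    fun_prop
  have h0 : (γ : C(I, X)) 0 = F.projOver X e.1 := γ.source.trans e.2.symm
  have h := ((isCoveringMap_projOver hX).eq_liftPath_iff h0 (Γ := Γ)).mpr ⟨hc, rfl, ?_⟩
  · change ((isCoveringMap_projOver hX).liftPath γ e h0 1).1.1.2 = v 1
    rw [← h]
  · refine Subtype.ext (Subtype.ext (Prod.ext ?_ he))
    change (γ 0).1 = e.1.1.1.1
    rw [γ.source, fiber_base]

theorem IsLift.unique {γ : I → Fin N → ℂ} (hγ : Continuous γ) (hr : ∀ t, γ t ∈ F.regularSet)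
    {v w : I → ℂ} (hv : F.IsLift γ v) (hw : F.IsLift γ w) (h0 : v 0 = w 0) : v = w := by
  have cov := isCoveringMap_projOver (F := F) subset_rfl
  have h := cov.eq_of_comp_eq (A := I)
    (g₁ := fun t => (⟨⟨(γ t, v t), hv.2 t⟩, hr t⟩ : F.proj ⁻¹' F.regularSet))
    (g₂ := fun t => (⟨⟨(γ t, w t), hw.2 t⟩, hr t⟩ : F.proj ⁻¹' F.regularSet))
    (by have := hv.1; fun_prop) (by have := hw.1; fun_prop) rfl 0 (by simp only [h0])
  funext t
  exact congrArg (fun q : F.proj ⁻¹' F.regularSet => q.1.1.2) (congrFun h t)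

/-- The class of a loop in the fundamental group. -/
def loopClass {Y : Type*} [TopologicalSpace Y] {x : Y} (γ : Path x x) : FundamentalGroup Y x :=
  Path.Homotopic.Quotient.mk γ

theorem loopClass_surjective {Y : Type*} [TopologicalSpace Y] {x : Y} :
    Function.Surjective (loopClass : Path x x → FundamentalGroup Y x) :=
  Path.Homotopic.Quotient.mk_surjective

/-- The monodromy representation over `X`. -/
noncomputable def monodromyHom (F : EntireAlgFun N) (hX : X ⊆ F.regularSet) (x : X) :
    FundamentalGroup X x →* Equiv.Perm (F.projOver X ⁻¹' {x}) :=
  (isCoveringMap_projOver hX).monodromyPerm x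

theorem fiberVal_monodromyHom (hX : X ⊆ F.regularSet) {x : X} (γ : Path x x) {v : I → ℂ}
    (hv : F.IsLift (fun t => (γ t).1) v) (e : F.projOver X ⁻¹' {x}) (he : v 0 = fiberVal e) :
    fiberVal (F.monodromyHom hX x (loopClass γ) e) = v 1 :=
  monodromy_eq hX γ hv e he

/-- This dictionary lets all later arguments deal with continuous functions on the interval instead
of fibres and permutations. -/
theorem loopClass_mem_ker_monodromyHom (hX : X ⊆ F.regularSet) {x : X} (γ : Path x x) :
    loopClass γ ∈ (F.monodromyHom hX x).ker ↔
      ∀ v, F.IsLift (fun t => (γ t).1) v → v 1 = v 0 := by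
  rw [MonoidHom.mem_ker]
  constructor
  · intro h v hv
    have hv0 : v 0 ∈ F.values x.1 := by simpa using hv.2 0
    have := fiberVal_monodromyHom hX γ hv (fiberMk x hv0) rfl
    rw [h] at this
    exact this.symm
  · intro h
    ext1 e
    obtain ⟨v, hv, h0⟩ := exists_isLift_of_path hX (γ : C(I, X)) (v₀ := fiberVal e)
      (by simpa using fiberVal_mem e)
    refine fiberVal_injective ?_
    rw [fiberVal_monodromyHom hX γ hv e h0, h v hv, h0]
    rfl

theorem map_mem_ker_monodromyHom {Y : Set (Fin N → ℂ)} (hXY : X ⊆ Y) (hY : Y ⊆ F.regularSet)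
    {x : X} (k : FundamentalGroup X x) :
    FundamentalGroup.map ⟨Set.inclusion hXY, continuous_inclusion hXY⟩ x k ∈
      (F.monodromyHom hY (Set.inclusion hXY x)).ker ↔
      k ∈ (F.monodromyHom (hXY.trans hY) x).ker := by
  obtain ⟨γ, rfl⟩ := loopClass_surjective k
  rw [loopClass_mem_ker_monodromyHom]
  exact loopClass_mem_ker_monodromyHom hY
    (γ.map (f := Set.inclusion hXY) (continuous_inclusion hXY))

/-- The monodromy groups at the two ends of a path are conjugate. -/
theorem exists_conj_monodromyHom (hX : X ⊆ F.regularSet) {x y : X} (hxy : Joined x y) :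
    ∃ e : (F.projOver X ⁻¹' {x}) ≃ (F.projOver X ⁻¹' {y}), ∀ s,
      s ∈ (F.monodromyHom hX x).range → e.permCongr s ∈ (F.monodromyHom hX y).range := by
  obtain ⟨γ⟩ := hxy
  have cov := isCoveringMap_projOver hX
  let g : Path.Homotopic.Quotient x y := .mk γ
  refine ⟨Equiv.ofBijective _ (cov.monodromy_bijective g), ?_⟩
  rintro _ ⟨k, rfl⟩
  let k' : Path.Homotopic.Quotient x x := k
  refine ⟨(g.symm.trans (k'.trans g) : Path.Homotopic.Quotient y y), ?_⟩
  ext1 e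
  obtain ⟨e, rfl⟩ := (cov.monodromy_bijective g).2 e
  rw [Equiv.permCongr_apply, Equiv.ofBijective_symm_apply_apply]
  change cov.monodromy (g.symm.trans (k'.trans g)) (cov.monodromy g e) =
    cov.monodromy g (cov.monodromy k' e)
  rw [← cov.monodromy_trans_apply, ← cov.monodromy_trans_apply,
    ← Path.Homotopic.Quotient.trans_assoc, Path.Homotopic.Quotient.trans_symm,
    Path.Homotopic.Quotient.refl_trans]

end Lifts

end EntireAlgFun

/-! ### Pushing paths off a hypersurface -/

namespace EntireAlgFun

variable {N : ℕ}

/-- Bernstein approximations converge uniformly and interpolate exactly at both endpoints. Being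
polynomials, they extend to complex time. -/
theorem exists_polynomial_path_near (γ : C(I, Fin N → ℂ)) {ρ : ℝ} (hρ : 0 < ρ) :
    ∃ q : Fin N → Polynomial ℂ, (∀ t : I, dist (fun i => (q i).eval (t : ℂ)) (γ t) < ρ) ∧
      (fun i => (q i).eval 0) = γ 0 ∧ (fun i => (q i).eval 1) = γ 1 := by
  obtain ⟨n, hn, hn0⟩ := (((bernsteinApproximation_uniform γ).eventually
    (Metric.ball_mem_nhds γ hρ)).and (Filter.eventually_ne_atTop 0)).exists
  let q : Fin N → Polynomial ℂ := fun i =>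
    ∑ k : Fin (n + 1), Polynomial.C (γ (bernstein.z k) i) * bernsteinPolynomial ℂ n k
  have hq : ∀ t : I, (fun i => (q i).eval (t : ℂ)) = bernsteinApproximation n γ t := by
    intro t
    funext i
    rw [bernsteinApproximation.apply, Finset.sum_apply, Polynomial.eval_finsetSum]
    refine Finset.sum_congr rfl fun k _ => ?_
    rw [Pi.smul_apply, bernstein_apply, bernsteinPolynomial]
    simp
    ring
  refine ⟨q, fun t => ?_, ?_, ?_⟩
  · rw [hq]
    exact (ContinuousMap.dist_apply_le_dist t).trans_lt hn
  · simpa using hq 0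
  · simpa [hn0] using hq 1

/-- Along a polynomial path near `γ`, `D` becomes a nonzero polynomial in one complex variable. Its
finitely many zeros are avoided by replacing the time interval [0, 1] with a slightly bent arc in ℂ
having the same ends. The last conclusion provides a straight-line homotopy inside `R`. -/
theorem exists_path_avoiding {R : Set (Fin N → ℂ)} (hR : IsOpen R) {D : MvPolynomial (Fin N) ℂ}
    (γ : C(I, Fin N → ℂ)) (hγ : ∀ t, γ t ∈ R) (h0 : MvPolynomial.eval (γ 0) D ≠ 0)
    (h1 : MvPolynomial.eval (γ 1) D ≠ 0) :
    ∃ α : C(I, Fin N → ℂ), α 0 = γ 0 ∧ α 1 = γ 1 ∧ (∀ t, MvPolynomial.eval (α t) D ≠ 0) ∧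
      ∀ s t : I, (1 - s : ℝ) • γ t + (s : ℝ) • α t ∈ R := by
  obtain ⟨ρ, hρ, hρR⟩ := (isCompact_range γ.continuous).exists_thickening_subset_open hR
    (Set.range_subset_iff.mpr hγ)
  obtain ⟨q, hq, hq0, hq1⟩ := exists_polynomial_path_near γ (half_pos hρ)
  let f : ℂ → Fin N → ℂ := fun z i => (q i).eval z
  have hf : Continuous f := by fun_prop
  let P : Polynomial ℂ := MvPolynomial.aeval q D
  have hP : ∀ z, MvPolynomial.eval (f z) D = P.eval z := fun z => by
    simp only [P, f, ← Polynomial.coe_evalRingHom, MvPolynomial.aeval_def,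
      MvPolynomial.eval₂_eq', map_sum, map_mul, map_prod, map_pow, MvPolynomial.eval_eq']
    simp
  have hP0 : P.eval 0 ≠ 0 := by rw [← hP]; simpa only [f, hq0]
  have hP1 : P.eval 1 ≠ 0 := by rw [← hP]; simpa only [f, hq1]
  have hPne : P ≠ 0 := by rintro h; simp [h] at hP0
  let z : ℝ → I → ℂ := fun s t => t + Complex.I * (s * t * (1 - t))
  have hz : Continuous (fun p : ℝ × I => z p.1 p.2) := by fun_prop
  have hnear : ∀ᶠ s in 𝓝 (0 : ℝ), ∀ t ∈ (Set.univ : Set I),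
      dist (f (z s t)) (f (t : ℂ)) < ρ / 2 := by
    refine isCompact_univ.eventually_forall_of_forall_eventually fun t _ => ?_
    have hcont : Continuous fun p : ℝ × I => dist (f (z p.1 p.2)) (f (p.2 : ℂ)) := by fun_prop
    refine (isOpen_Iio.preimage hcont).mem_nhds ?_
    simp [z, hρ]
  -- A root ζ lies on the arc `z s` only if its real part is t and its imaginary part is s t (1 -
  -- t), which determines s.
  let bad : Finset ℝ := P.roots.toFinset.image fun ζ => ζ.im / (ζ.re * (1 - ζ.re))
  have hbad : ∀ s ∉ bad, ∀ t : I, P.eval (z s t) ≠ 0 := by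
    intro s hs t hroot
    refine hs (Finset.mem_image.mpr ⟨z s t, by simpa [hPne] using hroot, ?_⟩)
    have hre : (z s t).re = t := by simp [z]
    have him : (z s t).im = s * t * (1 - t) := by simp [z]
    have ht0 : (t : ℝ) ≠ 0 := fun h => hP0 (by simpa [z, h] using hroot)
    have ht1 : (1 - t : ℝ) ≠ 0 := fun h => hP1 (by
      have : (t : ℝ) = 1 := by linarith
      simpa [z, this] using hroot)
    rw [hre, him]
    field_simp
  have hnear' : ∀ᶠ s in 𝓝[≠] (0 : ℝ), ∀ t ∈ (Set.univ : Set I),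
      dist (f (z s t)) (f (t : ℂ)) < ρ / 2 := nhdsWithin_le_nhds hnear
  have hbad' : ∀ᶠ s in 𝓝[≠] (0 : ℝ), s ∈ (bad : Set ℝ)ᶜ :=
    nhdsNE_le_cofinite (0 : ℝ) bad.finite_toSet.compl_mem_cofinite
  obtain ⟨s, hs1, hs2⟩ := (hnear'.and hbad').exists
  refine ⟨⟨fun t => f (z s t), by fun_prop⟩, ?_, ?_, fun t => ?_, fun r t => ?_⟩
  · simpa [z, f] using hq0
  · simpa [z, f] using hq1
  · change MvPolynomial.eval (f (z s t)) D ≠ 0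
    rw [hP]
    exact hbad s hs2 t
  · refine hρR (Metric.mem_thickening_iff.mpr ⟨γ t, ⟨t, rfl⟩, ?_⟩)
    have h2 : dist (f (z s t)) (γ t) < ρ := by
      have := dist_triangle (f (z s t)) (f t) (γ t)
      have := hs1 t trivial
      have := hq t
      simp only [f] at *
      linarith
    have h3 : (1 - r : ℝ) • γ t + (r : ℝ) • f (z s t) - γ t = (r : ℝ) • (f (z s t) - γ t) := by
      module
    change dist ((1 - r : ℝ) • γ t + (r : ℝ) • f (z s t)) (γ t) < ρ
    rw [dist_eq_norm, h3, norm_smul, ← dist_eq_norm, Real.norm_of_nonneg r.2.1]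
    exact (mul_le_of_le_one_left dist_nonneg r.2.2).trans_lt h2

/-- The part of `U` off the zero set of the polynomial `D`. -/
def nonvanishing (U : Set (Fin N → ℂ)) (D : MvPolynomial (Fin N) ℂ) : Set (Fin N → ℂ) :=
  U ∩ {x | MvPolynomial.eval x D ≠ 0}

theorem isOpen_nonvanishing {U : Set (Fin N → ℂ)} (hU : IsOpen U) (D : MvPolynomial (Fin N) ℂ) :
    IsOpen (nonvanishing U D) :=
  hU.inter (isOpen_compl_singleton.preimage (MvPolynomial.continuous_eval D))

/-- A ball in the maximum norm is a product of infinite sets, and a polynomial vanishing on such a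
product is zero. -/
theorem exists_eval_ne_zero {U : Set (Fin N → ℂ)} (hU : IsOpen U) (hne : U.Nonempty)
    {D : MvPolynomial (Fin N) ℂ} (hD : D ≠ 0) : (nonvanishing U D).Nonempty := by
  by_contra! h
  obtain ⟨x, hx⟩ := hne
  obtain ⟨r, hr, hball⟩ := Metric.isOpen_iff.mp hU x hx
  refine hD (MvPolynomial.funext_set (fun i => Metric.ball (x i) r)
    (fun i => infinite_of_mem_nhds (x i) (Metric.ball_mem_nhds _ hr)) fun y hy => ?_)
  by_contra hy0
  have hyU : y ∈ Metric.ball x r := by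
    rw [Metric.mem_ball, dist_pi_lt_iff hr]
    exact fun i => hy i (Set.mem_univ i)
  exact Set.eq_empty_iff_forall_notMem.mp h y ⟨hball hyU, by simpa using hy0⟩

theorem joined_nonvanishing {U : Set (Fin N → ℂ)} (hU : IsOpen U) (hc : Convex ℝ U)
    {D : MvPolynomial (Fin N) ℂ} (x y : nonvanishing U D) : Joined x y := by
  obtain ⟨α, h0, h1, hD, hα⟩ := exists_path_avoiding (D := D) hU
    ⟨fun t : I => (1 - t : ℝ) • x.1 + (t : ℝ) • y.1, by fun_prop⟩
    (fun t => hc x.2.1 y.2.1 (sub_nonneg.mpr t.2.2) t.2.1 (by ring))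
    (by simpa using x.2.2) (by simpa using y.2.2)
  exact ⟨⟨⟨fun t => ⟨α t, by simpa using hα 1 t, hD t⟩, by fun_prop⟩,
    Subtype.ext (by simpa using h0), Subtype.ext (by simpa using h1)⟩⟩

/-- Removing the zero set of a polynomial from an open set `R` does not make loops disappear. -/
theorem map_inclusion_surjective {R R' : Set (Fin N → ℂ)} (hR : IsOpen R)
    {D : MvPolynomial (Fin N) ℂ} (hR' : R' = nonvanishing R D) (h : R' ⊆ R) (x : R') :
    Function.Surjective (FundamentalGroup.map
      ⟨Set.inclusion h, continuous_inclusion h⟩ x) := by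
  subst hR'
  intro k
  obtain ⟨γ, rfl⟩ := loopClass_surjective k
  obtain ⟨α, h0, h1, hD, hα⟩ := exists_path_avoiding (D := D) hR
    ⟨fun t => (γ t).1, by fun_prop⟩ (fun t => (γ t).2)
    (by simpa using x.2.2) (by simpa using x.2.2)
  let β : Path x x := ⟨⟨fun t => ⟨α t, by simpa using hα 1 t, hD t⟩, by fun_prop⟩,
    Subtype.ext (by simpa using h0), Subtype.ext (by simpa using h1)⟩
  refine ⟨loopClass β, Path.Homotopic.Quotient.eq.mpr ⟨.symm
    { toFun := fun p => ⟨_, hα p.1 p.2⟩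
      continuous_toFun := by
        have := γ.continuous
        simp only [ContinuousMap.coe_mk]
        fun_prop
      map_zero_left := fun t => ?_
      map_one_left := fun t => ?_
      prop' := ?_ }⟩⟩
  · exact Subtype.ext (by simp)
  · exact Subtype.ext (by simp; rfl)
  · rintro s t (rfl | rfl)
    · refine Subtype.ext ?_
      simp only [ContinuousMap.coe_mk, h0]
      module
    · refine Subtype.ext ?_
      simp only [ContinuousMap.coe_mk, h1]
      module

end EntireAlgFun

/-! ### Algebra: specialization of integral elements and primitive elements -/

theorem nonempty_algHom_of_isIntegral (S T Ω : Type*) [CommRing S] [IsDomain S] [CommRing T]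
    [IsDomain T] [Algebra S T] [FaithfulSMul S T] [Algebra.IsIntegral S T] [Field Ω]
    [IsAlgClosed Ω] [Algebra S Ω] [FaithfulSMul S Ω] : Nonempty (T →ₐ[S] Ω) :=
  ⟨IsAlgClosed.lift⟩

/-- A homomorphism to an algebraically closed field extends along an integral extension. -/
theorem RingHom.exists_extension_of_isIntegral {S T Ω : Type*} [CommRing S] [CommRing T]
    [Algebra S T] [Algebra.IsIntegral S T] (hinj : Function.Injective (algebraMap S T))
    [Field Ω] [IsAlgClosed Ω] (φ : S →+* Ω) :
    ∃ ψ : T →+* Ω, ψ.comp (algebraMap S T) = φ := by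
  have := RingHom.ker_isPrime φ
  -- A prime of `T` over the kernel of `φ` reduces the problem to an integral extension of domains,
  -- where the smaller one embeds into `Ω`.
  obtain ⟨Q, -, hQ, hQP⟩ := Ideal.exists_ideal_over_prime_of_isIntegral (RingHom.ker φ)
    (⊥ : Ideal T) (by
      rw [← RingHom.ker_eq_comap_bot, (RingHom.injective_iff_ker_eq_bot _).mp hinj]
      exact bot_le)
  have : Q.LiesOver (RingHom.ker φ) := ⟨hQP.symm⟩
  let : Algebra (S ⧸ RingHom.ker φ) Ω := (RingHom.kerLift φ).toAlgebra
  have : FaithfulSMul (S ⧸ RingHom.ker φ) Ω :=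
    (faithfulSMul_iff_algebraMap_injective _ _).mpr (RingHom.kerLift_injective φ)
  have : FaithfulSMul (S ⧸ RingHom.ker φ) (T ⧸ Q) :=
    Ideal.Quotient.instFaithfulSMul Q (RingHom.ker φ)
  obtain ⟨f⟩ := nonempty_algHom_of_isIntegral (S ⧸ RingHom.ker φ) (T ⧸ Q) Ω
  refine ⟨(f : (T ⧸ Q) →+* Ω).comp (Ideal.Quotient.mk Q), ?_⟩
  ext s
  exact f.commutes (Ideal.Quotient.mk _ s)

theorem Polynomial.isCoprime_of_irreducible_of_not_dvd {K : Type*} [Field K] {p q : Polynomial K}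
    (hp : Irreducible p) (h : ¬ p ∣ q) : IsCoprime p q :=
  hp.coprime_iff_not_dvd.mpr h

namespace EntireAlgFun

variable {N : ℕ}

/-- By Gauss's lemma the monic equation stays irreducible over the fraction field, hence is
separable in characteristic zero. -/
theorem discr_ne_zero (F : EntireAlgFun N) : F.eqn.discr ≠ 0 := by
  intro h
  let K := FractionRing (MvPolynomial (Fin N) ℂ)
  have h1 := Polynomial.resultant_deriv (Polynomial.natDegree_pos_iff_degree_pos.mp F.natDegree_pos)
  rw [h, mul_zero] at h1
  have h2 := congrArg (algebraMap _ K) h1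
  rw [← Polynomial.resultant_map_map, ← Polynomial.derivative_map, map_zero] at h2
  have hirr : Irreducible (F.eqn.map (algebraMap _ K)) :=
    F.monic.irreducible_iff_irreducible_map_fraction_map.mp F.irreducible
  have hdeg : (F.eqn.map (algebraMap _ K)).natDegree = F.eqn.natDegree := F.monic.natDegree_map _
  have hdeg' : (F.eqn.map (algebraMap _ K)).derivative.natDegree = F.eqn.natDegree - 1 := by
    rw [Polynomial.natDegree_derivative, hdeg]
  rw [← hdeg', ← hdeg] at h2
  exact (Polynomial.resultant_eq_zero_iff.mp h2).2 hirr.separable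

/-- The coefficient of the relation expressing that a polynomial which is not a multiple of the
defining equation is coprime to it. -/
theorem exists_bezout (F : EntireAlgFun N) {q : Polynomial (MvPolynomial (Fin N) ℂ)}
    (hq : ¬ F.eqn ∣ q) : ∃ (a b : Polynomial (MvPolynomial (Fin N) ℂ))
      (r : MvPolynomial (Fin N) ℂ), r ≠ 0 ∧ F.eqn * a + q * b = Polynomial.C r := by
  let K := FractionRing (MvPolynomial (Fin N) ℂ)
  obtain ⟨a, b, -, -, h⟩ := Polynomial.exists_mul_add_mul_eq_C_resultant F.eqn q le_rfl le_rfl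
    (Or.inl F.natDegree_pos.ne')
  refine ⟨a, b, _, fun h0 => ?_, h⟩
  have hinj : Function.Injective (algebraMap (MvPolynomial (Fin N) ℂ) K) :=
    IsFractionRing.injective _ _
  have h2 := congrArg (algebraMap _ K) h0
  rw [← Polynomial.resultant_map_map, map_zero,
    ← Polynomial.natDegree_map_eq_of_injective hinj F.eqn,
    ← Polynomial.natDegree_map_eq_of_injective hinj q] at h2
  have hirr : Irreducible (F.eqn.map (algebraMap _ K)) :=
    F.monic.irreducible_iff_irreducible_map_fraction_map.mp F.irreducible
  refine (Polynomial.resultant_eq_zero_iff.mp h2).2 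
    (Polynomial.isCoprime_of_irreducible_of_not_dvd hirr fun hd => ?_)
  exact hq ((Polynomial.map_dvd_map _ hinj F.monic).mp hd)

/-- Specialisation: if `b` satisfies no relation over the polynomials but the multiples of the
defining equation of `F`, it may be sent to any root of this equation. -/
theorem exists_specialization (F : EntireAlgFun N) {B : Type*} [CommRing B]
    [Algebra (MvPolynomial (Fin N) ℂ) B] (b : integralClosure (MvPolynomial (Fin N) ℂ) B)
    (hb : ∀ q, Polynomial.aeval b q = 0 ↔ F.eqn ∣ q)
    {Ω : Type*} [Field Ω] [IsAlgClosed Ω] (f : MvPolynomial (Fin N) ℂ →+* Ω) {w : Ω}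
    (hw : F.eqn.eval₂ f w = 0) :
    ∃ ψ : integralClosure (MvPolynomial (Fin N) ℂ) B →+* Ω,
      (∀ a, ψ (algebraMap _ _ a) = f a) ∧ ψ b = w := by
  let A := MvPolynomial (Fin N) ℂ
  let T := integralClosure A B
  let ι : AdjoinRoot F.eqn →+* T := AdjoinRoot.lift (algebraMap A T) b ((hb _).mpr dvd_rfl)
  let : Algebra (AdjoinRoot F.eqn) T := ι.toAlgebra
  have hinj : Function.Injective ι := by
    rw [injective_iff_map_eq_zero]
    intro a ha
    obtain ⟨q, rfl⟩ := AdjoinRoot.mk_surjective a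
    exact AdjoinRoot.mk_eq_zero.mpr ((hb q).mp ((AdjoinRoot.lift_mk _ _).symm.trans ha))
  have : IsScalarTower A (AdjoinRoot F.eqn) T :=
    .of_algebraMap_eq fun a => (AdjoinRoot.lift_of _).symm
  have : Algebra.IsIntegral (AdjoinRoot F.eqn) T := Algebra.IsIntegral.tower_top A
  obtain ⟨ψ, hψ⟩ := RingHom.exists_extension_of_isIntegral hinj (AdjoinRoot.lift f w hw)
  refine ⟨ψ, fun a => ?_, ?_⟩
  · have := congrArg (fun g : AdjoinRoot F.eqn →+* Ω => g (AdjoinRoot.of _ a)) hψ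
    simp only [RingHom.comp_apply, AdjoinRoot.lift_of] at this
    rw [← this]
    exact congrArg ψ (AdjoinRoot.lift_of _).symm
  · have := congrArg (fun g : AdjoinRoot F.eqn →+* Ω => g (AdjoinRoot.root _)) hψ
    simp only [RingHom.comp_apply, AdjoinRoot.lift_root] at this
    rw [← this]
    exact congrArg ψ (AdjoinRoot.lift_root _).symm

/-- The roots of the defining equation in a ring extending the polynomials satisfy no other
relations than the multiples of this equation. -/
theorem aeval_eq_zero_iff_dvd (F : EntireAlgFun N) {B : Type*} [CommRing B]
    [Algebra (MvPolynomial (Fin N) ℂ) B] [FaithfulSMul (MvPolynomial (Fin N) ℂ) B] {b : B}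
    (hb : Polynomial.aeval b F.eqn = 0) (q : Polynomial (MvPolynomial (Fin N) ℂ)) :
    Polynomial.aeval b q = 0 ↔ F.eqn ∣ q := by
  refine ⟨fun h => ?_, fun ⟨r, hr⟩ => by rw [hr, map_mul, hb, zero_mul]⟩
  by_contra hd
  obtain ⟨a, c, r, hr, h2⟩ := F.exists_bezout hd
  have h3 := congrArg (Polynomial.aeval b) h2
  rw [map_add, map_mul, map_mul, h, hb, zero_mul, zero_mul, zero_add, Polynomial.aeval_C] at h3
  exact hr ((map_eq_zero_iff _ (FaithfulSMul.algebraMap_injective _ _)).mp h3.symm)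

/-- A finite family of algebraic functions is expressed rationally through a single one. -/
theorem exists_primitive {ι : Type*} [Finite ι]
    (y : ι → AlgebraicClosure (FractionRing (MvPolynomial (Fin N) ℂ))) :
    ∃ (M : EntireAlgFun N)
      (θ : integralClosure (MvPolynomial (Fin N) ℂ)
        (AlgebraicClosure (FractionRing (MvPolynomial (Fin N) ℂ))))
      (d : ι → MvPolynomial (Fin N) ℂ) (P : ι → Polynomial (MvPolynomial (Fin N) ℂ)),
      Polynomial.aeval θ M.eqn = 0 ∧ (∀ i, d i ≠ 0) ∧
      ∀ i, algebraMap _ _ (d i) * y i =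
        Polynomial.aeval (θ : AlgebraicClosure (FractionRing (MvPolynomial (Fin N) ℂ))) (P i) := by
  let A := MvPolynomial (Fin N) ℂ
  let K := FractionRing A
  let L := AlgebraicClosure K
  let E := IntermediateField.adjoin K (Set.range y)
  have : FiniteDimensional K E := by
    have : Finite (Set.range y) := Set.finite_range y
    exact IntermediateField.finiteDimensional_adjoin fun x _ =>
      (Algebra.IsAlgebraic.isAlgebraic x).isIntegral
  obtain ⟨α, hα⟩ := Field.exists_primitive_element K E
  -- The primitive element is only algebraic over the polynomials; the multiple θ = aα is integral
  -- and generates the same field.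
  have halg : IsAlgebraic A (α : L) :=
    (IsFractionRing.isAlgebraic_iff A K L).mpr (Algebra.IsAlgebraic.isAlgebraic _)
  obtain ⟨a, ha, hint⟩ := halg.exists_integral_multiple
  let θ : integralClosure A L := ⟨a • (α : L), hint⟩
  have hθ : IsIntegral A θ := Algebra.IsIntegral.isIntegral θ
  have haK : algebraMap A K a ≠ 0 := by
    simpa using ha
  have hgen : ∀ i, ∃ p : Polynomial K, y i = Polynomial.aeval (θ : L) p := by
    intro i
    let z : E := ⟨y i, IntermediateField.subset_adjoin K _ ⟨i, rfl⟩⟩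
    have hz : z ∈ (IntermediateField.adjoin K {α}).toSubalgebra := by
      rw [hα]; trivial
    rw [IntermediateField.adjoin_simple_toSubalgebra_of_isAlgebraic
      (Algebra.IsAlgebraic.isAlgebraic α), Algebra.adjoin_singleton_eq_range_aeval] at hz
    obtain ⟨p, hp⟩ := hz
    have hp' : Polynomial.aeval (α : L) p = y i := by
      have := congrArg (algebraMap E L) hp
      exact (Polynomial.aeval_algebraMap_apply L α p).trans this
    refine ⟨p.comp (Polynomial.C (algebraMap A K a)⁻¹ * Polynomial.X), ?_⟩
    rw [Polynomial.aeval_comp, map_mul, Polynomial.aeval_C, Polynomial.aeval_X, ← hp']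
    congr 2
    change (α : L) = algebraMap K L (algebraMap A K a)⁻¹ * (a • (α : L))
    rw [Algebra.smul_def, IsScalarTower.algebraMap_apply A K L, ← mul_assoc, ← map_mul,
      inv_mul_cancel₀ haK, map_one, one_mul]
  choose p hp using hgen
  choose b hb hbp using fun i => IsLocalization.integerNormalization_spec (nonZeroDivisors A) (p i)
  have : Module.IsTorsionFree A L := .trans_faithfulSMul A K L
  have : Module.IsTorsionFree A (integralClosure A L) :=
    Subtype.val_injective.moduleIsTorsionFree _ fun _ _ => rfl
  -- The polynomial ring is integrally closed, so the minimal polynomial of θ over it is an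
  -- admissible defining equation. The `b i` are the cleared denominators.
  refine ⟨⟨minpoly A θ, minpoly.monic hθ, (minpoly.prime_of_isIntegrallyClosed hθ).irreducible⟩,
    θ, b, fun i => IsLocalization.integerNormalization (nonZeroDivisors A) (p i),
    minpoly.aeval A θ, fun i => nonZeroDivisors.ne_zero (hb i), fun i => ?_⟩
  rw [← Polynomial.aeval_map_algebraMap K, hbp, ← IsScalarTower.algebraMap_smul K (b i) (p i),
    map_smul, ← hp, Algebra.smul_def, ← IsScalarTower.algebraMap_apply]

end EntireAlgFun

/-! ### Compositions as algebraic relations, and their continuation -/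

namespace EntireAlgFun

theorem algebraMap_algebraicClosure_injective (A : Type*) [CommRing A] [IsDomain A] :
    Function.Injective (algebraMap A (AlgebraicClosure (FractionRing A))) := by
  rw [IsScalarTower.algebraMap_eq A (FractionRing A)]
  exact (algebraMap (FractionRing A) _).injective.comp (IsFractionRing.injective A _)

variable {N : ℕ}

/-- The relations between branches `g_i` of `G_i` and `h` of `H` in a composition, for elements of
an arbitrary ring over the polynomials. -/
def CompRelation {k : ℕ} (Φ : EntireAlgFun k) (G : Fin k → EntireAlgFun N) (H : EntireAlgFun N)
    {B : Type*} [CommRing B] (c : MvPolynomial (Fin N) ℂ →+* B) (g : Fin k → B) (h : B) : Prop :=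
  (∀ i, (G i).eqn.eval₂ c (g i) = 0) ∧ H.eqn.eval₂ c h = 0 ∧
    Φ.eqn.eval₂ (MvPolynomial.eval₂Hom (c.comp MvPolynomial.C) g) h = 0

section CompRelation

variable {k : ℕ} {Φ : EntireAlgFun k} {G : Fin k → EntireAlgFun N} {H : EntireAlgFun N}
  {B B' : Type*} [CommRing B] [CommRing B'] {c : MvPolynomial (Fin N) ℂ →+* B} {g : Fin k → B}
  {h : B}

theorem compRelation_map_iff {ψ : B →+* B'} (hψ : Function.Injective ψ) :
    CompRelation Φ G H (ψ.comp c) (fun i => ψ (g i)) (ψ h) ↔ CompRelation Φ G H c g h := by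
  simp only [CompRelation, RingHom.comp_assoc, ← Polynomial.hom_eval₂,
    ← MvPolynomial.comp_eval₂Hom, map_eq_zero_iff ψ hψ]

theorem CompRelation.map (hr : CompRelation Φ G H c g h) (ψ : B →+* B') :
    CompRelation Φ G H (ψ.comp c) (fun i => ψ (g i)) (ψ h) := by
  simp only [CompRelation, RingHom.comp_assoc, ← Polynomial.hom_eval₂,
    ← MvPolynomial.comp_eval₂Hom]
  exact ⟨fun i => by rw [hr.1 i, map_zero], by rw [hr.2.1, map_zero], by rw [hr.2.2, map_zero]⟩

theorem mem_values_iff (F : EntireAlgFun N) {x : Fin N → ℂ} {v : ℂ} :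
    v ∈ F.values x ↔ F.eqn.eval₂ (MvPolynomial.eval x) v = 0 := by
  rw [← Polynomial.eval_map]
  rfl

theorem compRelation_eval_iff {x : Fin N → ℂ} {g : Fin k → ℂ} {h : ℂ} :
    CompRelation Φ G H (MvPolynomial.eval x) g h ↔
      (∀ i, g i ∈ (G i).values x) ∧ h ∈ H.values x ∧ h ∈ Φ.values g := by
  have : MvPolynomial.eval₂Hom ((MvPolynomial.eval x).comp MvPolynomial.C) g =
      MvPolynomial.eval g := by
    ext <;> simp
  simp only [CompRelation, mem_values_iff, this]

theorem compRelation_pi {ι : Type*} {x : ι → Fin N → ℂ} {g : Fin k → ι → ℂ} {h : ι → ℂ}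
    (hr : ∀ j, CompRelation Φ G H (MvPolynomial.eval (x j)) (fun i => g i j) (h j)) :
    CompRelation Φ G H (RingHom.pi fun j => MvPolynomial.eval (x j)) g h := by
  have hc : ∀ j, (Pi.evalRingHom (fun _ : ι => ℂ) j).comp
      (RingHom.pi fun j => MvPolynomial.eval (x j)) = MvPolynomial.eval (x j) := fun j => rfl
  refine ⟨fun i => funext fun j => ?_, funext fun j => ?_, funext fun j => ?_⟩
  · have := Polynomial.hom_eval₂ (G i).eqn (RingHom.pi fun j => MvPolynomial.eval (x j))
      (Pi.evalRingHom (fun _ : ι => ℂ) j) (g i)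
    rw [hc] at this
    exact this.trans ((hr j).1 i)
  · have := Polynomial.hom_eval₂ H.eqn (RingHom.pi fun j => MvPolynomial.eval (x j))
      (Pi.evalRingHom (fun _ : ι => ℂ) j) h
    rw [hc] at this
    exact this.trans (hr j).2.1
  · have := Polynomial.hom_eval₂ Φ.eqn (MvPolynomial.eval₂Hom
      ((RingHom.pi fun j => MvPolynomial.eval (x j)).comp MvPolynomial.C) g)
      (Pi.evalRingHom (fun _ : ι => ℂ) j) h
    rw [MvPolynomial.comp_eval₂Hom, ← RingHom.comp_assoc, hc] at this
    exact this.trans (hr j).2.2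

/-- The relations of a composition, lifted to the integral closure. -/
theorem CompRelation.exists_integralClosure [Algebra (MvPolynomial (Fin N) ℂ) B]
    (hr : CompRelation Φ G H (algebraMap _ B) g h) :
    ∃ (g' : Fin k → integralClosure (MvPolynomial (Fin N) ℂ) B)
      (h' : integralClosure (MvPolynomial (Fin N) ℂ) B), (∀ i, (g' i : B) = g i) ∧ (h' : B) = h ∧
      CompRelation Φ G H (algebraMap _ _) g' h' := by
  refine ⟨fun i => ⟨g i, (G i).eqn, (G i).monic, hr.1 i⟩, ⟨h, H.eqn, H.monic, hr.2.1⟩,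
    fun _ => rfl, rfl, ?_⟩
  exact (compRelation_map_iff
    (ψ := (integralClosure (MvPolynomial (Fin N) ℂ) B).val.toRingHom)
    Subtype.val_injective).mp hr

/-- The branches live in the ring of functions on `V`, where the polynomials embed because `V` is
open and nonempty. They are integral, and the integral closure maps to the algebraic closure over
the polynomials, taking the relations with it. -/
theorem IsComposition.exists_algebraic (hc : IsComposition Φ G H) :
    ∃ (g : Fin k → integralClosure (MvPolynomial (Fin N) ℂ)
        (AlgebraicClosure (FractionRing (MvPolynomial (Fin N) ℂ))))
      (h : integralClosure (MvPolynomial (Fin N) ℂ)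
        (AlgebraicClosure (FractionRing (MvPolynomial (Fin N) ℂ)))),
      CompRelation Φ G H (algebraMap _ _) g h := by
  obtain ⟨V, hV, hne, g, h, hg, hh, hΦ⟩ := hc
  let A := MvPolynomial (Fin N) ℂ
  let L := AlgebraicClosure (FractionRing A)
  let c : A →+* (V → ℂ) := RingHom.pi fun x : V => MvPolynomial.eval x.1
  let : Algebra A (V → ℂ) := c.toAlgebra
  have hr : CompRelation Φ G H c (fun i (x : V) => g i x) (fun x : V => h x) :=
    compRelation_pi fun x => compRelation_eval_iff.mpr
      ⟨fun i => (hg i).2 x x.2, hh.2 x x.2, hΦ x x.2⟩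
  obtain ⟨g', h', -, -, hr'⟩ := CompRelation.exists_integralClosure (B := V → ℂ) hr
  have hinj : Function.Injective (algebraMap A (integralClosure A (V → ℂ))) := by
    rw [injective_iff_map_eq_zero]
    intro a ha
    by_contra h0
    obtain ⟨x, hx, hx0⟩ := exists_eval_ne_zero hV hne h0
    exact hx0 (congrFun (congrArg Subtype.val ha) ⟨x, hx⟩)
  have : FaithfulSMul A (integralClosure A (V → ℂ)) :=
    (faithfulSMul_iff_algebraMap_injective _ _).mpr hinj
  obtain ⟨w, hw⟩ := IsAlgClosed.exists_eval₂_eq_zero_of_injective (algebraMap A L)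
    (algebraMap_algebraicClosure_injective A) H.eqn (by
      rw [Polynomial.degree_eq_natDegree H.monic.ne_zero]
      exact_mod_cast H.natDegree_pos.ne')
  obtain ⟨ψ, hψ, -⟩ := H.exists_specialization (B := V → ℂ) h'
    (H.aeval_eq_zero_iff_dvd hr'.2.1) (algebraMap A L) hw
  have hψ' : ψ.comp (algebraMap A (integralClosure A (V → ℂ))) = algebraMap A L :=
    RingHom.ext hψ
  have h3 := hr'.map ψ
  rw [hψ'] at h3
  obtain ⟨g₂, h₂, -, -, h4⟩ := h3.exists_integralClosure
  exact ⟨g₂, h₂, h4⟩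

/-- The branches in a composition are rational functions of a single algebraic function. -/
theorem IsComposition.exists_parametrization (hc : IsComposition Φ G H) :
    ∃ (M : EntireAlgFun N) (d : Option (Fin k) → MvPolynomial (Fin N) ℂ)
      (P : Option (Fin k) → Polynomial (MvPolynomial (Fin N) ℂ)), (∀ i, d i ≠ 0) ∧
      ∀ x, (∀ i, MvPolynomial.eval x (d i) ≠ 0) →
        (∀ θ ∈ M.values x, CompRelation Φ G H (MvPolynomial.eval x)
          (fun i => (P (some i)).eval₂ (MvPolynomial.eval x) θ / MvPolynomial.eval x (d (some i)))
          ((P none).eval₂ (MvPolynomial.eval x) θ / MvPolynomial.eval x (d none))) ∧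
        ∀ v ∈ H.values x, ∃ θ ∈ M.values x,
          (P none).eval₂ (MvPolynomial.eval x) θ / MvPolynomial.eval x (d none) = v := by
  obtain ⟨g, h, hr⟩ := hc.exists_algebraic
  let A := MvPolynomial (Fin N) ℂ
  let L := AlgebraicClosure (FractionRing A)
  let T := integralClosure A L
  -- The index `none` stands for h, and `some i` for g_i.
  let y : Option (Fin k) → T := fun i => i.elim h g
  obtain ⟨M, θ, d, P, hM, hd, hP⟩ := exists_primitive fun i => (y i : L)
  have : FaithfulSMul A T := (faithfulSMul_iff_algebraMap_injective _ _).mpr fun a b hab =>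
    algebraMap_algebraicClosure_injective A (congrArg Subtype.val hab)
  have hP' : ∀ i, algebraMap A T (d i) * y i = Polynomial.aeval θ (P i) := fun i =>
    Subtype.ext ((hP i).trans (Polynomial.aeval_algebraMap_apply L θ (P i)))
  have hval : ∀ (x : Fin N → ℂ) (ψ : T →+* ℂ), (∀ a, ψ (algebraMap A T a) =
      MvPolynomial.eval x a) → ∀ i, MvPolynomial.eval x (d i) ≠ 0 →
      (P i).eval₂ (MvPolynomial.eval x) (ψ θ) / MvPolynomial.eval x (d i) = ψ (y i) := by
    intro x ψ hψ i hi
    have hψ' : ψ.comp (algebraMap A T) = MvPolynomial.eval x := RingHom.ext hψ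
    have h1 := congrArg ψ (hP' i)
    rw [Polynomial.aeval_def, Polynomial.hom_eval₂, hψ', map_mul, hψ] at h1
    rw [← h1, mul_div_cancel_left₀ _ hi]
  refine ⟨M, d, P, hd, fun x hx => ⟨fun t ht => ?_, fun v hv => ?_⟩⟩
  · obtain ⟨ψ, hψ, rfl⟩ := M.exists_specialization θ (M.aeval_eq_zero_iff_dvd hM)
      (MvPolynomial.eval x) (M.mem_values_iff.mp ht)
    have h2 := hr.map ψ
    rw [show ψ.comp (algebraMap A T) = MvPolynomial.eval x from RingHom.ext hψ] at h2
    simp only [hval x ψ hψ _ (hx _)]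
    exact h2
  · obtain ⟨ψ, hψ, rfl⟩ := H.exists_specialization h (H.aeval_eq_zero_iff_dvd hr.2.1)
      (MvPolynomial.eval x) (H.mem_values_iff.mp hv)
    refine ⟨ψ θ, ?_, hval x ψ hψ none (hx none)⟩
    rw [mem_values_iff]
    have h1 := congrArg ψ hM
    rwa [Polynomial.aeval_def, Polynomial.hom_eval₂, map_zero,
      show ψ.comp (algebraMap A T) = MvPolynomial.eval x from RingHom.ext hψ] at h1

theorem subset_regularSet_of_dvd {F : EntireAlgFun N} {D : MvPolynomial (Fin N) ℂ}
    (h : F.eqn.discr ∣ D) (U : Set (Fin N → ℂ)) : nonvanishing U D ⊆ F.regularSet := by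
  rintro x ⟨-, hx⟩ h0
  obtain ⟨E, rfl⟩ := h
  exact hx (by rw [map_mul, h0, zero_mul])

/-- Off a hypersurface, the continuation of a composition is the composition of
continuations. -/
theorem IsComposition.exists_isLift (hc : IsComposition Φ G H) :
    ∃ D : MvPolynomial (Fin N) ℂ, D ≠ 0 ∧ ∀ γ : I → Fin N → ℂ, Continuous γ →
      (∀ t, MvPolynomial.eval (γ t) D ≠ 0) → (∀ t, γ t ∈ H.regularSet) →
      ∀ h, H.IsLift γ h → ∃ g : Fin k → I → ℂ, (∀ i, (G i).IsLift γ (g i)) ∧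
        ∀ t, h t ∈ Φ.values fun i => g i t := by
  obtain ⟨M, d, P, hd, hP⟩ := hc.exists_parametrization
  refine ⟨M.eqn.discr * ∏ i, d i, mul_ne_zero M.discr_ne_zero
    (Finset.prod_ne_zero_iff.mpr fun i _ => hd i), fun γ hγ hD hH h hh => ?_⟩
  simp only [map_mul, map_prod, ne_eq, mul_eq_zero, not_or, Finset.prod_eq_zero_iff,
    not_exists, not_and, Finset.mem_univ, true_imp_iff] at hD
  -- A parameter value over the initial value of `h` is continued along `γ`; all branches follow as
  -- rational functions of it, and uniqueness of lifts identifies the one for H with `h`.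
  obtain ⟨θ₀, hθ₀, h0⟩ := (hP (γ 0) (hD 0).2).2 (h 0) (hh.2 0)
  obtain ⟨θ, hθ, rfl⟩ := M.exists_isLift hγ (fun t => (hD t).1) hθ₀
  let y : Option (Fin k) → I → ℂ := fun i t =>
    (P i).eval₂ (MvPolynomial.eval (γ t)) (θ t) / MvPolynomial.eval (γ t) (d i)
  have hy : ∀ i, Continuous (y i) := by
    intro i
    refine Continuous.div ?_ ((MvPolynomial.continuous_eval _).comp hγ) fun t => (hD t).2 i
    simp only [Polynomial.eval₂_eq_sum_range]
    exact continuous_finsetSum _ fun j _ =>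
      ((MvPolynomial.continuous_eval _).comp hγ).mul (hθ.1.pow j)
  have hrel := fun t => compRelation_eval_iff.mp ((hP (γ t) (hD t).2).1 (θ t) (hθ.2 t))
  have heq : y none = h := IsLift.unique hγ hH ⟨hy none, fun t => (hrel t).2.1⟩ hh h0
  exact ⟨fun i => y (some i), fun i => ⟨hy _, fun t => (hrel t).1 i⟩,
    fun t => heq ▸ (hrel t).2.2⟩

end CompRelation

end EntireAlgFun

/-! ### Values near a point, and logarithms of branches -/

theorem eq_of_continuous_of_mem_finite {v : I → ℂ} (hv : Continuous v) {S : Set ℂ} (hS : S.Finite)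
    (h : ∀ t, v t ∈ S) (s t : I) : v s = v t :=
  hS.countable.isTotallyDisconnected (Set.range v) (Set.range_subset_iff.mpr h)
    (isPreconnected_range hv) ⟨s, rfl⟩ ⟨t, rfl⟩

/-- A continuous function on the interval with values close to the points of a separated set
remains close to one of them. -/
theorem dist_lt_of_separated {v : I → ℂ} (hv : Continuous v) {W : Set ℂ} {r : ℝ}
    (hW : ∀ c ∈ W, ∀ c' ∈ W, c ≠ c' → 2 * r ≤ dist c c') (h : ∀ t, ∃ c ∈ W, dist (v t) c < r)
    {c : ℂ} (hc : c ∈ W) (h0 : dist (v 0) c < r) (t : I) : dist (v t) c < r := by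
  let S : Set I := {t | dist (v t) c < r}
  have hSo : IsOpen S := isOpen_lt (by fun_prop) continuous_const
  have hSc : Sᶜ = ⋃ c' ∈ W \ {c}, {t | dist (v t) c' < r} := by
    ext s
    simp only [S, Set.mem_compl_iff, Set.mem_ofPred_eq, Set.mem_iUnion, exists_prop]
    constructor
    · intro hs
      obtain ⟨c', hc', hd⟩ := h s
      exact ⟨c', ⟨hc', fun hcc => hs (hcc ▸ hd)⟩, hd⟩
    · rintro ⟨c', ⟨hc', hne⟩, hd⟩ hs
      have := hW c hc c' hc' (Ne.symm hne)
      have := dist_triangle_left c c' (v s)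
      linarith
  have hclosed : IsClosed S := by
    rw [← isOpen_compl_iff, hSc]
    exact isOpen_biUnion fun c' _ => isOpen_lt (by fun_prop) continuous_const
  have := IsClopen.eq_univ ⟨hclosed, hSo⟩ ⟨0, h0⟩
  exact Set.eq_univ_iff_forall.mp this t

namespace EntireAlgFun

variable {N : ℕ}

theorem finite_values (F : EntireAlgFun N) (x : Fin N → ℂ) : (F.values x).Finite := by
  refine ((F.finite_fiber x).image fun q => q.1.2).subset fun v hv => ?_
  exact ⟨⟨(x, v), hv⟩, rfl, rfl⟩

/-- The values at points near `p` are near the values at `p`. -/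
theorem eventually_values_near (F : EntireAlgFun N) (p : Fin N → ℂ) {r : ℝ} (hr : 0 < r) :
    ∀ᶠ x in 𝓝 p, ∀ v ∈ F.values x, ∃ c ∈ F.values p, dist v c < r := by
  let S : Set F.graph := {q | ∀ c ∈ F.values p, r ≤ dist q.1.2 c}
  have hS : IsClosed S := by
    simp only [S, Set.ofPred_forall]
    exact isClosed_biInter fun c _ => isClosed_le continuous_const (by fun_prop)
  have hp : p ∉ F.proj '' S := by
    rintro ⟨q, hq, rfl⟩
    have := hq _ q.2
    rw [dist_self] at this
    linarith
  filter_upwards [(F.isClosedMap_proj S hS).isOpen_compl.mem_nhds hp] with x hx v hv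
  by_contra! h
  exact hx ⟨⟨(x, v), hv⟩, h, rfl⟩

theorem finite_compl_regularSet (Φ : EntireAlgFun 1) : {u : ℂ | (fun _ => u) ∉ Φ.regularSet}.Finite := by
  let P : Polynomial ℂ := MvPolynomial.aeval (fun _ => Polynomial.X) Φ.eqn.discr
  have hP : ∀ u : ℂ, MvPolynomial.eval (fun _ => u) Φ.eqn.discr = P.eval u := fun u => by
    simp only [P, ← Polynomial.coe_evalRingHom, MvPolynomial.aeval_def,
      MvPolynomial.eval₂_eq', map_sum, map_mul, map_prod, map_pow, MvPolynomial.eval_eq']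
    simp
  have hne : P ≠ 0 := by
    intro h0
    obtain ⟨x, -, hx⟩ := exists_eval_ne_zero isOpen_univ Set.univ_nonempty Φ.discr_ne_zero
    refine hx ?_
    rw [show x = fun _ => x 0 from funext fun i => by rw [Subsingleton.elim i 0], hP, h0,
      Polynomial.eval_zero]
  refine P.roots.toFinset.finite_toSet.subset fun u hu => ?_
  have hu' : MvPolynomial.eval (fun _ => u) Φ.eqn.discr = 0 := by
    simpa [regularSet] using hu
  rw [hP] at hu'
  simpa [hne] using hu'

/-- Isolation of the points of a finite set from another one. -/
theorem exists_isolating_radius {S W : Set ℂ} (hS : S.Finite) (hW : W.Finite) :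
    ∃ r > 0, ∀ c ∈ W, ∀ u ∈ S, u ≠ c → r ≤ dist c u := by
  have h : ∀ᶠ r in 𝓝[>] (0 : ℝ), ∀ q ∈ W ×ˢ S, q.2 ≠ q.1 → r ≤ dist q.1 q.2 := by
    refine (Filter.eventually_all_finite (hW.prod hS)).mpr fun q _ => ?_
    by_cases hq : q.2 = q.1
    · exact Filter.Eventually.of_forall fun r h => absurd hq h
    · filter_upwards [Ioo_mem_nhdsGT (dist_pos.mpr (Ne.symm hq))] with r hr _
      exact hr.2.le
  obtain ⟨r, hr, hr0⟩ := (h.and self_mem_nhdsWithin).exists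
  exact ⟨r, hr0, fun c hc u hu => hr (c, u) ⟨hc, hu⟩⟩

/-- Around an isolated singular point, a function of one variable is a single-valued function of
the logarithm. -/
theorem isLift_exp_closed {Φ : EntireAlgFun 1} {c : ℂ} {r : ℝ} (hr : 0 < r)
    (hΦ : ∀ u, u ≠ c → dist c u < r → (fun _ => u) ∈ Φ.regularSet) {L : I → ℂ}
    (hL : Continuous L) (hLr : ∀ t, ‖Complex.exp (L t)‖ < r) (hL1 : L 1 = L 0) {v : I → ℂ}
    (hv : Φ.IsLift (fun t _ => c + Complex.exp (L t)) v) : v 1 = v 0 := by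
  let A : Set ℂ := {z | ‖Complex.exp z‖ < r}
  have hA : A = Complex.re ⁻¹' Set.Iio (Real.log r) := by
    ext z
    simp only [A, Set.mem_ofPred_eq, Complex.norm_exp, Set.mem_preimage, Set.mem_Iio]
    exact (Real.lt_log_iff_exp_lt hr).symm
  have hAo : IsOpen A := by rw [hA]; exact isOpen_Iio.preimage Complex.continuous_re
  have hAc : Convex ℝ A := by
    rw [hA]
    exact (convex_Iio _).linear_preimage Complex.reLm
  -- The logarithms of points of the punctured disc form a half-plane. It is simply connected, so
  -- the values of Φ lift to a global function `Y` there.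
  have : ContractibleSpace A := hAc.contractibleSpace ⟨L 0, hLr 0⟩
  have : LocallyPathConnectedSpace A := hAo.locallyPathConnectedSpace
  have hreg : ∀ z ∈ A, (fun _ : Fin 1 => c + Complex.exp z) ∈ Φ.regularSet := fun z hz =>
    hΦ _ (by simp) (by rw [dist_self_add_right]; exact hz)
  have cov := isCoveringMap_projOver (F := Φ) subset_rfl
  let f : C(A, Φ.regularSet) := ⟨fun z => ⟨fun _ => c + Complex.exp z, hreg z z.2⟩, by fun_prop⟩
  obtain ⟨Y, ⟨hY0, hY⟩, -⟩ := cov.existsUnique_continuousMap_lifts f ⟨L 0, hLr 0⟩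
    (fiberMk (f ⟨L 0, hLr 0⟩) (hv.2 0)).1 rfl
  let L' : I → A := fun t => ⟨L t, hLr t⟩
  have hL' : Continuous L' := by fun_prop
  have hYL : Φ.IsLift (fun t _ => c + Complex.exp (L t)) fun t => (Y (L' t)).1.1.2 := by
    refine ⟨by fun_prop, fun t => ?_⟩
    have hb : (Y (L' t)).1.1.1 = fun _ => c + Complex.exp (L t) :=
      congrArg Subtype.val (congrFun hY (L' t))
    change (Y (L' t)).1.1.2 ∈ Φ.values fun _ => c + Complex.exp (L t)
    rw [← hb]
    exact (Y (L' t)).1.2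
  have heq : v = fun t => (Y (L' t)).1.1.2 := by
    refine IsLift.unique (by fun_prop) (fun t => hreg _ (hLr t)) hv hYL ?_
    change v 0 = (Y ⟨L 0, hLr 0⟩).1.1.2
    rw [hY0]
    rfl
  rw [heq]
  simp only [L', hL1]

/-- `L` is a logarithm of `g - c` along `γ`, for a continuation `g` of `G`. -/
def IsLogLift (G : EntireAlgFun N) (c : ℂ) {X : Set (Fin N → ℂ)} (γ : I → X) (L : I → ℂ) : Prop :=
  G.IsLift (fun t => (γ t).1) fun t => c + Complex.exp (L t)

section LogLift

variable {G : EntireAlgFun N} {c : ℂ} {X : Set (Fin N → ℂ)} {x y z : X} {a b d : ℂ}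

/-- Two successive covering lifts: first to the graph of G, then of g - c through exp onto the
punctured plane. -/
theorem exists_isLogLift (hX : X ⊆ G.regularSet) (hc : ∀ x ∈ X, c ∉ G.values x) (γ : Path x y)
    (ha : c + Complex.exp a ∈ G.values x.1) :
    ∃ (b : ℂ) (L : Path a b), G.IsLogLift c γ L := by
  obtain ⟨g, hg, hg0⟩ := exists_isLift_of_path hX (γ : C(I, X)) (v₀ := c + Complex.exp a)
    (by simpa using ha)
  have hgc : ∀ t, g t - c ≠ 0 := fun t h => hc _ (γ t).2 (sub_eq_zero.mp h ▸ hg.2 t)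
  have := hg.1
  obtain ⟨Γ, h1, h2⟩ := Complex.isCoveringMap_exp.exists_path_lifts
    ⟨fun t => ⟨g t - c, hgc t⟩, by fun_prop⟩ a (Subtype.ext (by simp [hg0]))
  refine ⟨Γ 1, ⟨Γ, h2, rfl⟩, ?_⟩
  have h3 : ∀ t, Complex.exp (Γ t) = g t - c := fun t => congrArg Subtype.val (congrFun h1 t)
  have h4 : (fun t => c + Complex.exp (Γ t)) = g := funext fun t => by rw [h3]; ring
  change G.IsLift _ fun t => c + Complex.exp (Γ t)
  rw [h4]
  exact hg

theorem IsLogLift.symm {γ : Path x y} {L : Path a b} (h : G.IsLogLift c γ L) :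
    G.IsLogLift c γ.symm L.symm :=
  ⟨by fun_prop, fun t => h.2 (σ t)⟩

theorem IsLogLift.trans {γ : Path x y} {γ' : Path y z} {L : Path a b} {L' : Path b d}
    (h : G.IsLogLift c γ L) (h' : G.IsLogLift c γ' L') :
    G.IsLogLift c (γ.trans γ') (L.trans L') := by
  refine ⟨by fun_prop, fun t => ?_⟩
  simp only [Path.trans_apply]
  split_ifs
  · exact h.2 _
  · exact h'.2 _

theorem IsLogLift.translate {γ : Path x y} {L : Path a b} (h : G.IsLogLift c γ L) {s a' b' : ℂ}
    (hs : Complex.exp s = 1) (ha : a' = a + s) (hb : b' = b + s) :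
    ∃ L' : Path a' b', G.IsLogLift c γ L' := by
  subst ha hb
  refine ⟨L.map (continuous_add_const s), ?_⟩
  have : (fun t => c + Complex.exp (L.map (continuous_add_const s) t)) =
      fun t => c + Complex.exp (L t) := by
    funext t
    simp [Complex.exp_add, hs]
  change G.IsLift _ _
  rw [this]
  exact h

theorem IsLogLift.exp_sub_eq_one {γ : Path x x} {L : Path a b} (h : G.IsLogLift c γ L)
    (hX : X ⊆ G.regularSet) (hγ : loopClass γ ∈ (G.monodromyHom hX x).ker) :
    Complex.exp (b - a) = 1 := by
  have h1 := (loopClass_mem_ker_monodromyHom hX γ).mp hγ _ h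
  rw [Complex.exp_sub]
  simp only [Path.source, Path.target, add_right_inj] at h1
  rw [h1, div_self (Complex.exp_ne_zero a)]

/-- A commutator of loops along which `G` is single-valued is the loop `δ`; the logarithm of
`G - c` is single-valued along it. -/
theorem exists_isLogLift_commutator (hX : X ⊆ G.regularSet) (hc : ∀ x ∈ X, c ∉ G.values x)
    (γ₁ γ₂ : Path x x) (h₁ : loopClass γ₁ ∈ (G.monodromyHom hX x).ker)
    (h₂ : loopClass γ₂ ∈ (G.monodromyHom hX x).ker) (ha : c + Complex.exp a ∈ G.values x.1) :
    ∃ L : Path a a, G.IsLogLift c (γ₂.symm.trans (γ₁.symm.trans (γ₂.trans γ₁))) L := by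
  obtain ⟨b₁, L₁, hL₁⟩ := exists_isLogLift hX hc γ₁.symm ha
  obtain ⟨b₂, L₂, hL₂⟩ := exists_isLogLift hX hc γ₂.symm ha
  have e₁ := hL₁.exp_sub_eq_one hX (inv_mem h₁)
  have e₂ := hL₂.exp_sub_eq_one hX (inv_mem h₂)
  -- The logarithm runs a → b₂ → b₁ + b₂ - a → b₁ → a. The two middle paths are translates by the
  -- periods b₂ - a and b₁ - a.
  obtain ⟨L₃, hL₃⟩ := hL₁.translate e₂ (a' := b₂) (b' := b₁ + b₂ - a) (by ring) (by ring)
  obtain ⟨L₄, hL₄⟩ := hL₂.symm.translate e₁ (a' := b₁ + b₂ - a) (b' := b₁) (by ring) (by ring)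
  rw [Path.symm_symm] at hL₄
  have hL₅ := hL₁.symm
  rw [Path.symm_symm] at hL₅
  exact ⟨_, hL₂.trans (hL₃.trans (hL₄.trans hL₅))⟩

end LogLift

end EntireAlgFun

/-! ### Solvability of the local monodromy by induction on compositions -/

namespace EntireAlgFun

variable {N : ℕ}

/-- The monodromy of `F` near `p`, off a suitable hypersurface, is solvable. -/
def SolvableNear (F : EntireAlgFun N) (p : Fin N → ℂ) : Prop :=
  ∃ D : MvPolynomial (Fin N) ℂ, D ≠ 0 ∧ F.eqn.discr ∣ D ∧ ∀ᶠ ε in 𝓝[>] (0 : ℝ),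
    ∀ D', D ∣ D' → ∀ (hX : nonvanishing (Metric.ball p ε) D' ⊆ F.regularSet)
      (x : nonvanishing (Metric.ball p ε) D'),
      ∃ n, derivedSeries (FundamentalGroup (nonvanishing (Metric.ball p ε) D') x) n ≤
        (F.monodromyHom hX x).ker

theorem mem_values_ofPolynomial {P : MvPolynomial (Fin N) ℂ} {x : Fin N → ℂ} {v : ℂ} :
    v ∈ (ofPolynomial P).values x ↔ v = MvPolynomial.eval x P := by
  simp [mem_values_iff, ofPolynomial, sub_eq_zero]

theorem solvableNear_ofPolynomial (P : MvPolynomial (Fin N) ℂ) (p : Fin N → ℂ) :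
    (ofPolynomial P).SolvableNear p := by
  refine ⟨_, (ofPolynomial P).discr_ne_zero, dvd_rfl, Filter.Eventually.of_forall
    fun ε D' _ hX x => ⟨0, fun k _ => ?_⟩⟩
  obtain ⟨γ, rfl⟩ := loopClass_surjective k
  refine (loopClass_mem_ker_monodromyHom hX γ).mpr fun v hv => ?_
  rw [mem_values_ofPolynomial.mp (hv.2 1), mem_values_ofPolynomial.mp (hv.2 0)]
  simp

/-- The monodromy is solvable if continuation along iterated commutators of loops which fix the
arguments of a composition fixes the composition. -/
theorem SolvableNear.of_comp {k : ℕ} {G : Fin k → EntireAlgFun N} {H : EntireAlgFun N}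
    {p : Fin N → ℂ} (hG : ∀ i, (G i).SolvableNear p) {D₀ : MvPolynomial (Fin N) ℂ}
    (hD₀ : D₀ ≠ 0)
    (h : ∀ᶠ ε in 𝓝[>] (0 : ℝ), ∀ D', D₀ ∣ D' →
      ∀ (hX : nonvanishing (Metric.ball p ε) D' ⊆ H.regularSet)
        (hXG : ∀ i, nonvanishing (Metric.ball p ε) D' ⊆ (G i).regularSet)
        (x : nonvanishing (Metric.ball p ε) D')
        (K : Subgroup (FundamentalGroup (nonvanishing (Metric.ball p ε) D') x)),
        (∀ i, K ≤ ((G i).monodromyHom (hXG i) x).ker) →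
        ⁅K, K⁆ ≤ (H.monodromyHom hX x).ker) :
    H.SolvableNear p := by
  choose D hD hdvd hs using hG
  refine ⟨H.eqn.discr * D₀ * ∏ i, D i, mul_ne_zero (mul_ne_zero H.discr_ne_zero hD₀)
    (Finset.prod_ne_zero_iff.mpr fun i _ => hD i), ⟨D₀ * ∏ i, D i, by ring⟩, ?_⟩
  filter_upwards [h, Filter.eventually_all.mpr hs] with ε hε hsε D' hD' hX x
  have hDi : ∀ i, D i ∣ D' := fun i =>
    ((Finset.dvd_prod_of_mem D (Finset.mem_univ i)).trans (dvd_mul_left _ _)).trans hD'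
  have hXG : ∀ i, nonvanishing (Metric.ball p ε) D' ⊆ (G i).regularSet := fun i =>
    subset_regularSet_of_dvd ((hdvd i).trans (hDi i)) _
  choose n hn using fun i => hsε i D' (hDi i) (hXG i) x
  -- The term of index sup n of the derived series closes all the arguments; one more commutator
  -- closes H.
  exact ⟨Finset.univ.sup n + 1, hε D' ((Dvd.intro_left _ rfl).trans
    ((dvd_mul_right _ _).trans hD')) hX hXG x (derivedSeries _ (Finset.univ.sup n)) fun i =>
      (derivedSeries_antitone _ (Finset.le_sup (Finset.mem_univ i))).trans (hn i)⟩

theorem solvableNear_comp_polynomial {k : ℕ} {P : MvPolynomial (Fin k) ℂ}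
    {G : Fin k → EntireAlgFun N} {H : EntireAlgFun N} {p : Fin N → ℂ}
    (hG : ∀ i, (G i).SolvableNear p) (hc : IsComposition (ofPolynomial P) G H) :
    H.SolvableNear p := by
  obtain ⟨D₀, hD₀, hlift⟩ := hc.exists_isLift
  refine .of_comp hG hD₀ (Filter.Eventually.of_forall
    fun ε D' hD' hX hXG x K hK => (Subgroup.commutator_le_self K).trans fun k hk => ?_)
  obtain ⟨γ, rfl⟩ := loopClass_surjective k
  refine (loopClass_mem_ker_monodromyHom hX γ).mpr fun h hh => ?_
  obtain ⟨g, hg, hgh⟩ := hlift (fun t => (γ t).1) (by fun_prop)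
    (fun t => ne_zero_of_dvd_ne_zero (γ t).2.2 (map_dvd (MvPolynomial.eval (γ t).1) hD'))
    (fun t => hX (γ t).2) h hh
  rw [mem_values_ofPolynomial.mp (hgh 1), mem_values_ofPolynomial.mp (hgh 0)]
  congr 2
  funext i
  exact (loopClass_mem_ker_monodromyHom (hXG i) γ).mp (hK i hk) _ (hg i)

/-- The polynomial vanishing at the points where `c` is a value. -/
theorem eval_eval_eqn (F : EntireAlgFun N) (c : ℂ) (x : Fin N → ℂ) :
    MvPolynomial.eval x (F.eqn.eval (MvPolynomial.C c)) = 0 ↔ c ∈ F.values x := by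
  rw [mem_values_iff, Polynomial.eval, Polynomial.hom_eval₂]
  simp

theorem values_eq_singleton (F : EntireAlgFun N) {c : ℂ} (h : F.eqn.eval (MvPolynomial.C c) = 0)
    (x : Fin N → ℂ) {v : ℂ} (hv : v ∈ F.values x) : v = c := by
  have hassoc : Associated (Polynomial.X - Polynomial.C (MvPolynomial.C c)) F.eqn :=
    (Polynomial.irreducible_X_sub_C _).associated_of_dvd F.irreducible
      (Polynomial.dvd_iff_isRoot.mpr h)
  have heq := Polynomial.eq_of_monic_of_associated (Polynomial.monic_X_sub_C _) F.monic hassoc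
  rw [mem_values_iff, ← heq] at hv
  simpa [sub_eq_zero] using hv

/-- The essential step: monodromy of Φ around an isolated singular point is governed by a logarithm,
whose periods are abelian, so commutators suffice. -/
theorem solvableNear_comp_oneVariable {Φ : EntireAlgFun 1} {G : Fin 1 → EntireAlgFun N}
    {H : EntireAlgFun N} {p : Fin N → ℂ} (hG : ∀ i, (G i).SolvableNear p)
    (hc : IsComposition Φ G H) : H.SolvableNear p := by
  obtain ⟨D₁, hD₁, hlift⟩ := hc.exists_isLift
  -- If G is a constant c, then the locus where G takes the value c is the whole space and cannot be
  -- removed; but then h has values in the finite set Φ(c) and is constant along paths.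
  by_cases hconst : ∃ c ∈ (G 0).values p, (G 0).eqn.eval (MvPolynomial.C c) = 0
  · obtain ⟨c, -, hc0⟩ := hconst
    refine .of_comp hG hD₁ (Filter.Eventually.of_forall fun ε D' hD' hX hXG x K hK k _ => ?_)
    obtain ⟨γ, rfl⟩ := loopClass_surjective k
    refine (loopClass_mem_ker_monodromyHom hX γ).mpr fun h hh => ?_
    obtain ⟨g, hg, hgh⟩ := hlift (fun t => (γ t).1) (by fun_prop)
      (fun t => ne_zero_of_dvd_ne_zero (γ t).2.2 (map_dvd (MvPolynomial.eval (γ t).1) hD'))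
      (fun t => hX (γ t).2) h hh
    have hgc : ∀ t, (fun i => g i t) = fun _ => c := fun t => funext fun i => by
      rw [Subsingleton.elim i 0]
      exact (G 0).values_eq_singleton hc0 _ ((hg 0).2 t)
    simp only [hgc] at hgh
    exact eq_of_continuous_of_mem_finite hh.1 (Φ.finite_values _) hgh 1 0
  push Not at hconst
  have hW := (G 0).finite_values p
  -- This radius separates the values of G at `p` from each other and from the other singular points
  -- of Φ.
  obtain ⟨r, hr, hiso⟩ := exists_isolating_radius (Φ.finite_compl_regularSet.union hW) hW
  have hΦ : ∀ c ∈ (G 0).values p, ∀ u, u ≠ c → dist c u < r / 2 →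
      (fun _ => u) ∈ Φ.regularSet := by
    intro c hc u hu hd
    by_contra hreg
    have := hiso c hc u (Or.inl hreg) hu
    linarith
  have hsep : ∀ c ∈ (G 0).values p, ∀ c' ∈ (G 0).values p, c ≠ c' → 2 * (r / 2) ≤ dist c c' :=
    fun c hc c' hc' hne => by
      have := hiso c hc c' (Or.inr hc') hne.symm
      linarith
  obtain ⟨δ, hδ, hnear⟩ := Metric.eventually_nhds_iff_ball.mp
    ((G 0).eventually_values_near p (half_pos hr))
  -- The product removes the points where G takes one of its values at `p`, so that log(g - c) makes
  -- sense.
  refine .of_comp hG (D₀ := D₁ * ∏ c ∈ hW.toFinset, (G 0).eqn.eval (MvPolynomial.C c))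
    (mul_ne_zero hD₁ (Finset.prod_ne_zero_iff.mpr fun c hc => hconst c (by simpa using hc))) ?_
  filter_upwards [Ioo_mem_nhdsGT hδ] with ε hε D' hD' hX hXG x K hK
  refine Subgroup.commutator_le.mpr fun k₁ hk₁ k₂ hk₂ => ?_
  obtain ⟨γ₁, rfl⟩ := loopClass_surjective k₁
  obtain ⟨γ₂, rfl⟩ := loopClass_surjective k₂
  -- Products in the fundamental group are traversed from right to left, so this is the commutator
  -- of k₁ and k₂.
  let γ := γ₂.symm.trans (γ₁.symm.trans (γ₂.trans γ₁))
  change loopClass γ ∈ _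
  refine (loopClass_mem_ker_monodromyHom hX γ).mpr fun h hh => ?_
  have hne : ∀ y ∈ nonvanishing (Metric.ball p ε) D',
      MvPolynomial.eval y (D₁ * ∏ c ∈ hW.toFinset, (G 0).eqn.eval (MvPolynomial.C c)) ≠ 0 :=
    fun y hy => ne_zero_of_dvd_ne_zero hy.2 (map_dvd (MvPolynomial.eval y) hD')
  simp only [map_mul, map_prod, ne_eq, mul_eq_zero, not_or, Finset.prod_eq_zero_iff, not_exists,
    not_and, eval_eval_eqn, Set.Finite.mem_toFinset] at hne
  obtain ⟨g, hg, hgh⟩ := hlift (fun t => (γ t).1) (by fun_prop) (fun t => (hne _ (γ t).2).1)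
    (fun t => hX (γ t).2) h hh
  have hgn : ∀ t, ∃ c ∈ (G 0).values p, dist (g 0 t) c < r / 2 := fun t =>
    hnear _ (Metric.ball_subset_ball hε.2.le (γ t).2.1) _ ((hg 0).2 t)
  obtain ⟨c, hcp, hc0⟩ := hgn 0
  have hgc := dist_lt_of_separated (hg 0).1 hsep hgn hcp hc0
  have hcX : ∀ y ∈ nonvanishing (Metric.ball p ε) D', c ∉ (G 0).values y := fun y hy =>
    (hne y hy).2 c hcp
  have hg0 : g 0 0 - c ≠ 0 := fun h0 => hcX _ (γ 0).2 (sub_eq_zero.mp h0 ▸ (hg 0).2 0)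
  obtain ⟨L, hL⟩ := exists_isLogLift_commutator (a := Complex.log (g 0 0 - c)) (hXG 0) hcX γ₁ γ₂
    (hK 0 hk₁) (hK 0 hk₂) (by
      rw [Complex.exp_log hg0, add_sub_cancel]
      simpa using (hg 0).2 0)
  have hgL : g 0 = fun t => c + Complex.exp (L t) :=
    IsLift.unique (by fun_prop) (fun t => hXG 0 (γ t).2) (hg 0) hL (by
      simp [Complex.exp_log hg0])
  have hgL' : ∀ t, (fun i => g i t) = fun _ => c + Complex.exp (L t) := fun t => funext fun i => by
    rw [Subsingleton.elim i 0]
    exact congrFun hgL t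
  refine isLift_exp_closed (half_pos hr) (hΦ c hcp) L.continuous (fun t => ?_) (by simp)
    ⟨hh.1, fun t => ?_⟩
  · have := hgc t
    rwa [congrFun hgL t, dist_self_add_left] at this
  · change h t ∈ Φ.values fun _ => c + Complex.exp (L t)
    rw [← hgL' t]
    exact hgh t

theorem IsExpressible.solvableNear {y : EntireAlgFun N}
    (hy : IsExpressible IsPolynomialOrOneVariable y) (p : Fin N → ℂ) : y.SolvableNear p := by
  induction hy with
  | coord i => exact solvableNear_ofPolynomial _ p
  | comp Φ G H hΦ hG hH ih =>
    cases hΦ with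
    | polynomial P => exact solvableNear_comp_polynomial ih hH
    | oneVariable => exact solvableNear_comp_oneVariable ih hH

/-- Every loop in `R` is homotopic to one in `R'`, and a surjection maps derived series onto derived
series. -/
theorem derivedSeries_le_ker_of_subset {F : EntireAlgFun N} {R R' : Set (Fin N → ℂ)}
    (hR : IsOpen R) {D : MvPolynomial (Fin N) ℂ} (hR' : R' = nonvanishing R D) (h : R' ⊆ R)
    (hX : R ⊆ F.regularSet) (x : R') {n : ℕ}
    (hn : derivedSeries (FundamentalGroup R' x) n ≤ (F.monodromyHom (h.trans hX) x).ker) :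
    derivedSeries (FundamentalGroup R (Set.inclusion h x)) n ≤
      (F.monodromyHom hX (Set.inclusion h x)).ker := by
  have hsurj := map_inclusion_surjective hR hR' h x
  rintro k hk
  obtain ⟨k', hk', rfl⟩ := Subgroup.mem_map.mp ((map_derivedSeries_eq hsurj n).ge hk)
  exact (map_mem_ker_monodromyHom h hX k').mpr (hn hk')

theorem _root_.MonoidHom.isSolvable_range_of_derivedSeries_le_ker {A B : Type*} [Group A] [Group B]
    (f : A →* B) {n : ℕ} (h : derivedSeries A n ≤ f.ker) : Group.IsSolvable f.range := by
  refine ⟨⟨n, ?_⟩⟩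
  rw [← map_derivedSeries_eq f.rangeRestrict_surjective, Subgroup.map_eq_bot_iff,
    MonoidHom.ker_rangeRestrict]
  exact h

/-- The monodromy over a ball is not changed by removing further hypersurfaces. -/
theorem SolvableNear.hasSolvableLocalMonodromyAt {y : EntireAlgFun N} {p : Fin N → ℂ}
    (hy : y.SolvableNear p) : y.HasSolvableLocalMonodromyAt p := by
  obtain ⟨D, hD, hdvd, hs⟩ := hy
  filter_upwards [hs, self_mem_nhdsWithin] with ε hε hε0 x₀
  let U := Metric.ball p ε
  have hreg : y.regularIn U ⊆ y.regularSet := Set.inter_subset_right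
  have hopen : IsOpen (y.regularIn U) := isOpen_nonvanishing Metric.isOpen_ball y.eqn.discr
  -- The given base point may lie on D = 0. Solvability is obtained at a point off it and carried
  -- over by conjugation along a path.
  obtain ⟨x₁, hx₁⟩ := exists_eval_ne_zero (U := U) Metric.isOpen_ball
    (Metric.nonempty_ball.mpr hε0) hD
  have hsub : nonvanishing U D ⊆ y.regularIn U := fun x hx =>
    ⟨hx.1, subset_regularSet_of_dvd hdvd U hx⟩
  obtain ⟨n, hn⟩ := hε D dvd_rfl (hsub.trans hreg) ⟨x₁, hx₁⟩
  let x₁' : y.regularIn U := Set.inclusion hsub ⟨x₁, hx₁⟩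
  have hsol₁ : Group.IsSolvable (y.monodromyHom hreg x₁').range :=
    (y.monodromyHom hreg x₁').isSolvable_range_of_derivedSeries_le_ker
      (derivedSeries_le_ker_of_subset hopen (D := D) (by
        ext x
        exact ⟨fun hx => ⟨hsub hx, hx.2⟩, fun hx => ⟨hx.1.1, hx.2⟩⟩) hsub hreg ⟨x₁, hx₁⟩ hn)
  obtain ⟨e, he⟩ := exists_conj_monodromyHom hreg (x := x₀) (y := x₁')
    (joined_nonvanishing (D := y.eqn.discr) Metric.isOpen_ball (convex_ball p ε) x₀ x₁')
  let f : (y.monodromyHom hreg x₀).range →* (y.monodromyHom hreg x₁').range :=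
    (e.permCongrHom.toMonoidHom.comp (Subgroup.subtype _)).codRestrict _ fun s => he s s.2
  refine Group.isSolvable_of_isSolvable_injective (f := f) fun s t hst => Subtype.ext ?_
  exact e.permCongrHom.injective (congrArg Subtype.val hst)

end EntireAlgFun

/-! ### The quintic: discriminant and a 5-cycle -/

namespace EntireAlgFun

variable {N : ℕ}

/-- For a monic polynomial the discriminant is, up to sign, the resultant with the derivative, and
this commutes with evaluation of the coefficients. -/
theorem isCoprime_derivative_iff (F : EntireAlgFun N) (x : Fin N → ℂ) :
    x ∈ F.regularSet ↔ IsCoprime (F.eqnAt x) (F.eqnAt x).derivative := by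
  have h1 := Polynomial.resultant_deriv (Polynomial.natDegree_pos_iff_degree_pos.mp F.natDegree_pos)
  rw [F.monic.leadingCoeff, mul_one] at h1
  have h2 := congrArg (MvPolynomial.eval x) h1
  rw [← Polynomial.resultant_map_map, ← Polynomial.derivative_map] at h2
  have hdeg : (F.eqnAt x).natDegree = F.eqn.natDegree := F.monic.natDegree_map _
  have hdeg' : (F.eqnAt x).derivative.natDegree = F.eqn.natDegree - 1 := by
    rw [Polynomial.natDegree_derivative, hdeg]
  have h3 := Polynomial.resultant_eq_zero_iff (f := F.eqnAt x) (g := (F.eqnAt x).derivative)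
  rw [hdeg, hdeg'] at h3
  change Polynomial.resultant (F.eqnAt x) (F.eqnAt x).derivative _ _ = _ at h2
  rw [h2] at h3
  have h4 : F.eqnAt x ≠ 0 := (F.eqnAt_monic x).ne_zero
  simp [h4] at h3
  rw [← not_iff_not, ← h3]
  simp [regularSet]

theorem mem_regularSet_of_derivative_ne_zero (F : EntireAlgFun N) {x : Fin N → ℂ}
    (h : ∀ v ∈ F.values x, (F.eqnAt x).derivative.eval v ≠ 0) : x ∈ F.regularSet := by
  rw [isCoprime_derivative_iff,
    Polynomial.isCoprime_iff_aeval_ne_zero_of_isAlgClosed (k := ℂ) ℂ]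
  intro v
  by_cases hv : v ∈ F.values x
  · exact Or.inr (by simpa using h v hv)
  · exact Or.inl (by simpa using (show ¬ (F.eqnAt x).eval v = 0 from hv))

theorem card_values (F : EntireAlgFun N) {x : Fin N → ℂ} (hx : x ∈ F.regularSet) :
    Nat.card (F.values x) = F.eqn.natDegree := by
  classical
  have hsep : (F.eqnAt x).Separable := (F.isCoprime_derivative_iff x).mp hx
  have h1 : F.values x = (F.eqnAt x).roots.toFinset := by
    ext v
    simp [(F.eqnAt_monic x).ne_zero, values]
  rw [h1, Nat.card_eq_card_toFinset, Finset.toFinset_coe,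
    Multiset.toFinset_card_of_nodup (Polynomial.nodup_roots hsep),
    ← (IsAlgClosed.splits (F.eqnAt x)).natDegree_eq_card_roots, eqnAt, F.monic.natDegree_map]

theorem mem_quintic_values {x : Fin 2 → ℂ} {v : ℂ} :
    v ∈ quintic.values x ↔ v ^ 5 + x 0 * v + x 1 = 0 := by
  simp [values, eqnAt, quintic, quinticEqn]

theorem quintic_derivative {x : Fin 2 → ℂ} {v : ℂ} :
    (quintic.eqnAt x).derivative.eval v = 5 * v ^ 4 + x 0 := by
  simp [eqnAt, quintic, quinticEqn]
  norm_num

/-- A double root v forces a = -5v⁴ and b = 4v⁵, a parametrization of the curve 256a⁵ + 3125b⁴ = 0.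
-/
theorem mem_quintic_regularSet {x : Fin 2 → ℂ} (hx : 256 * x 0 ^ 5 + 3125 * x 1 ^ 4 ≠ 0) :
    x ∈ quintic.regularSet := by
  refine quintic.mem_regularSet_of_derivative_ne_zero fun v hv hd => hx ?_
  rw [mem_quintic_values] at hv
  rw [quintic_derivative] at hd
  have h0 : x 0 = -5 * v ^ 4 := by linear_combination hd
  have h1 : x 1 = 4 * v ^ 5 := by rw [h0] at hv; linear_combination hv
  rw [h0, h1]
  ring

theorem regularIn_subset (F : EntireAlgFun N) (U : Set (Fin N → ℂ)) :
    F.regularIn U ⊆ F.regularSet :=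
  Set.inter_subset_right

/-- The loop of the coefficient `b` around zero, for `a = 0`, permutes the values
transitively. -/
theorem quintic_exists_transitive {ε : ℝ} (hε : 0 < ε) :
    ∃ x : quintic.regularIn (Metric.ball 0 ε),
      ∀ e e' : quintic.projOver (quintic.regularIn (Metric.ball 0 ε)) ⁻¹' {x},
      ∃ s ∈ (quintic.monodromyHom (quintic.regularIn_subset _) x).range, s e = e' := by
  let f : I → Fin 2 → ℂ := fun t =>
    ![0, ((ε / 2 : ℝ) : ℂ) * Complex.exp (t * (2 * Real.pi * Complex.I))]
  have hf : Continuous f := by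
    refine continuous_pi fun i => ?_
    fin_cases i
    · exact continuous_const
    · simp only [f]
      fun_prop
  have hnorm : ∀ t : I, ‖((ε / 2 : ℝ) : ℂ) * Complex.exp (t * (2 * Real.pi * Complex.I))‖ = ε / 2 := by
    intro t
    rw [norm_mul, Complex.norm_real, Real.norm_of_nonneg (by positivity), Complex.norm_exp]
    simp
  have hmem : ∀ t, f t ∈ quintic.regularIn (Metric.ball 0 ε) := by
    refine fun t => ⟨?_, mem_quintic_regularSet ?_⟩
    · rw [mem_ball_zero_iff, pi_norm_lt_iff hε]
      intro i
      fin_cases i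
      · simpa [f] using hε
      · exact (hnorm t).trans_lt (by linarith)
    · have : f t 1 ≠ 0 := by
        rw [← norm_ne_zero_iff]
        exact (hnorm t).trans_ne (by positivity)
      simpa [f] using this
  have hloop : f 1 = f 0 := by simp [f, Complex.exp_two_pi_mul_I]
  let x : quintic.regularIn (Metric.ball 0 ε) := ⟨f 0, hmem 0⟩
  let γ : Path x x := ⟨⟨fun t => ⟨f t, hmem t⟩, by fun_prop⟩, rfl, Subtype.ext hloop⟩
  -- For a = 0 the equation is y⁵ = -b, so one turn of b multiplies each root by ω.
  let ω : ℂ := Complex.exp (2 * Real.pi * Complex.I / 5)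
  have hω : IsPrimitiveRoot ω 5 := by
    simpa using Complex.isPrimitiveRoot_exp 5 (by norm_num)
  let s := quintic.monodromyHom (quintic.regularIn_subset _) x (loopClass γ)
  have hval : ∀ e : quintic.projOver (quintic.regularIn (Metric.ball 0 ε)) ⁻¹' {x},
      fiberVal e ^ 5 = -((ε / 2 : ℝ) : ℂ) := by
    intro e
    have := mem_quintic_values.mp (fiberVal_mem e)
    simp only [x, f] at this
    simp at this
    simp
    linear_combination this
  have hs : ∀ e : quintic.projOver (quintic.regularIn (Metric.ball 0 ε)) ⁻¹' {x},
      fiberVal (s e) = ω * fiberVal e := by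
    intro e
    have hlift : quintic.IsLift (fun t => (γ t).1) fun t =>
        Complex.exp (t * (2 * Real.pi * Complex.I / 5)) * fiberVal e := by
      refine ⟨by fun_prop, fun t => ?_⟩
      rw [mem_quintic_values]
      change _ + (0 : ℂ) * _ + ((ε / 2 : ℝ) : ℂ) * Complex.exp (t * (2 * Real.pi * Complex.I)) = 0
      rw [mul_pow, hval, ← Complex.exp_nat_mul]
      have : ((5 : ℕ) : ℂ) * ((t : ℝ) * (2 * Real.pi * Complex.I / 5)) =
        (t : ℝ) * (2 * Real.pi * Complex.I) := by push_cast; ring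
      rw [this]
      ring
    rw [fiberVal_monodromyHom _ γ hlift e (by simp)]
    simp [ω]
  have hpow : ∀ (n : ℕ) (e : quintic.projOver (quintic.regularIn (Metric.ball 0 ε)) ⁻¹' {x}),
      fiberVal ((s ^ n) e) = ω ^ n * fiberVal e := by
    intro n e
    induction n with
    | zero => simp
    | succ n ih => rw [pow_succ', Equiv.Perm.mul_apply, hs, ih]; ring
  refine ⟨x, fun e e' => ?_⟩
  have he0 : fiberVal e ≠ 0 := by
    intro h
    have := hval e
    rw [h] at this
    have h2 : ε = 0 := by simpa using this
    linarith
  obtain ⟨n, -, hn⟩ := hω.eq_pow_of_pow_eq_one (ξ := fiberVal e' /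
    fiberVal e) (by
      rw [div_pow, hval, hval, div_self]
      rw [← hval e]
      exact pow_ne_zero _ he0)
  refine ⟨s ^ n, pow_mem (MonoidHom.mem_range.mpr ⟨loopClass γ, rfl⟩) n,
    fiberVal_injective ?_⟩
  rw [hpow, hn, div_mul_cancel₀ _ he0]

end EntireAlgFun

/-! ### The quintic: a transposition near the discriminant curve, and the full symmetric group -/

namespace EntireAlgFun

/-- The coefficients for which the values include the roots `s ± √δ`. -/
def quinticPoint (s δ : ℂ) : Fin 2 → ℂ :=
  ![-5 * s ^ 4 - 10 * s ^ 2 * δ - δ ^ 2, 4 * s ^ 5 - 4 * s * δ ^ 2]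

theorem continuous_quinticPoint (s : ℂ) : Continuous (quinticPoint s) := by
  refine continuous_pi fun i => ?_
  fin_cases i <;> simp only [quinticPoint] <;> fun_prop

/-- The factorization of the quintic with the roots `s ± √δ`. -/
theorem mem_values_quinticPoint {s δ v : ℂ} : v ∈ quintic.values (quinticPoint s δ) ↔
    ((v - s) ^ 2 - δ) * (v ^ 3 + 2 * s * v ^ 2 + (3 * s ^ 2 + δ) * v + 4 * s * (s ^ 2 + δ)) = 0 := by
  rw [mem_quintic_values]
  have h0 : quinticPoint s δ 0 = -5 * s ^ 4 - 10 * s ^ 2 * δ - δ ^ 2 := rfl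
  have h1 : quinticPoint s δ 1 = 4 * s ^ 5 - 4 * s * δ ^ 2 := rfl
  rw [h0, h1]
  constructor <;> intro h <;> linear_combination h

/-- The discriminant along δ ↦ `quinticPoint s δ` has a simple zero at δ = 0. With a = -5s⁴ and b =
4s⁵ the coefficients are a + δu and b + δw, and `Q` is the quotient of the discriminant by δ. -/
theorem eventually_quinticPoint_mem_regularSet {s : ℂ} (hs : s ≠ 0) :
    ∀ᶠ δ in 𝓝[≠] (0 : ℂ), quinticPoint s δ ∈ quintic.regularSet := by
  let a : ℂ := -5 * s ^ 4
  let b : ℂ := 4 * s ^ 5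
  let u : ℂ → ℂ := fun δ => -10 * s ^ 2 - δ
  let w : ℂ → ℂ := fun δ => -4 * s * δ
  let Q : ℂ → ℂ := fun δ =>
    256 * (u δ * (5 * a ^ 4 + 10 * a ^ 3 * (δ * u δ) + 10 * a ^ 2 * (δ * u δ) ^ 2 +
      5 * a * (δ * u δ) ^ 3 + (δ * u δ) ^ 4)) +
    3125 * (w δ * (4 * b ^ 3 + 6 * b ^ 2 * (δ * w δ) + 4 * b * (δ * w δ) ^ 2 + (δ * w δ) ^ 3))
  have hQ : Continuous Q := by fun_prop
  have hQ0 : Q 0 ≠ 0 := by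
    simp [Q, u, w, a, hs]
  filter_upwards [nhdsWithin_le_nhds (hQ.continuousAt.eventually_ne hQ0), self_mem_nhdsWithin]
    with δ hδ hδ0
  refine mem_quintic_regularSet ?_
  have : 256 * quinticPoint s δ 0 ^ 5 + 3125 * quinticPoint s δ 1 ^ 4 = δ * Q δ := by
    have h0 : quinticPoint s δ 0 = -5 * s ^ 4 - 10 * s ^ 2 * δ - δ ^ 2 := rfl
    have h1 : quinticPoint s δ 1 = 4 * s ^ 5 - 4 * s * δ ^ 2 := rfl
    rw [h0, h1]
    simp only [Q, u, w, a, b]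
    ring
  rw [this]
  exact mul_ne_zero hδ0 hδ

/-- Near a simple root, and for coefficients near the given ones, there is only one root. -/
theorem quintic_eventually_unique {a c : ℂ} (h : 5 * c ^ 4 + a ≠ 0) :
    ∀ᶠ r in 𝓝[>] (0 : ℝ), ∀ (x : Fin 2 → ℂ) (v w : ℂ), dist (x 0) a < r → dist v c < r →
      dist w c < r → v ∈ quintic.values x → w ∈ quintic.values x → v = w := by
  -- The divided difference of the quintic in y: it equals the derivative on the diagonal and
  -- vanishes at two distinct roots.
  let R : ℂ × ℂ × ℂ → ℂ := fun q =>
    q.2.1 ^ 4 + q.2.1 ^ 3 * q.2.2 + q.2.1 ^ 2 * q.2.2 ^ 2 + q.2.1 * q.2.2 ^ 3 + q.2.2 ^ 4 + q.1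
  have hR : Continuous R := by fun_prop
  have hR0 : R (a, c, c) ≠ 0 := by
    convert h using 1
    simp only [R]
    ring
  obtain ⟨η, hη, hball⟩ := Metric.eventually_nhds_iff_ball.mp (hR.continuousAt.eventually_ne hR0)
  filter_upwards [Ioo_mem_nhdsGT hη] with r hr x v w hx hv hw hvx hwx
  rw [mem_quintic_values] at hvx hwx
  have hne : R (x 0, v, w) ≠ 0 := hball _ (by
    simp only [Metric.mem_ball, Prod.dist_eq, sup_lt_iff]
    exact ⟨hx.trans hr.2, hv.trans hr.2, hw.trans hr.2⟩)
  refine sub_eq_zero.mp ((mul_eq_zero.mp ?_).resolve_right hne)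
  simp only [R]
  linear_combination hvx - hwx

/-- A lift along which the coefficients remain near a point of the discriminant is closed, unless
it starts at one of the two roots which come together at this point. -/
theorem quintic_exists_radius {s : ℂ} (hs : s ≠ 0) :
    ∃ r > 0, ∀ δ : I → ℂ, Continuous δ → (∀ t, ‖δ t‖ < r) → δ 1 = δ 0 →
      ∀ v, quintic.IsLift (fun t => quinticPoint s (δ t)) v → (v 0 - s) ^ 2 ≠ δ 0 →
        v 1 = v 0 := by
  let W := quintic.values (quinticPoint s 0)
  have hW : W.Finite := quintic.finite_values _
  obtain ⟨r₁, hr₁, hiso⟩ := exists_isolating_radius hW hW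
  have hsimple : ∀ c ∈ W, c ≠ s → 5 * c ^ 4 + -5 * s ^ 4 ≠ 0 := by
    intro c hc hcs h
    have h1 := mem_quintic_values.mp hc
    have h0 : quinticPoint s 0 0 = -5 * s ^ 4 := by simp [quinticPoint]
    have h2 : quinticPoint s 0 1 = 4 * s ^ 5 := by simp [quinticPoint]
    rw [h0, h2] at h1
    have h3 : s ^ 4 * (s - c) = 0 := by linear_combination (1 / 4 : ℂ) * h1 - (c / 20) * h
    exact hcs (sub_eq_zero.mp ((mul_eq_zero.mp h3).resolve_left (pow_ne_zero 4 hs))).symm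
  have hu : ∀ᶠ r in 𝓝[>] (0 : ℝ), ∀ c ∈ W, c ≠ s → ∀ (x : Fin 2 → ℂ) (v w : ℂ),
      dist (x 0) (-5 * s ^ 4) < r → dist v c < r → dist w c < r → v ∈ quintic.values x →
      w ∈ quintic.values x → v = w := by
    refine (Filter.eventually_all_finite hW).mpr fun c hc => ?_
    by_cases hcs : c = s
    · exact Filter.Eventually.of_forall fun r h => absurd hcs h
    · filter_upwards [quintic_eventually_unique (hsimple c hc hcs)] with r hr _
      exact hr
  -- The cubic cofactor does not vanish near (0, s), so roots close to s come from the quadratic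
  -- factor (v - s)² - δ.
  let C : ℂ × ℂ → ℂ := fun q =>
    q.2 ^ 3 + 2 * s * q.2 ^ 2 + (3 * s ^ 2 + q.1) * q.2 + 4 * s * (s ^ 2 + q.1)
  have hC : Continuous C := by fun_prop
  have hC0 : C (0, s) ≠ 0 := by
    have : C (0, s) = 10 * s ^ 3 := by simp only [C]; ring
    rw [this]
    simp [hs]
  obtain ⟨η, hη, hCη⟩ := Metric.eventually_nhds_iff_ball.mp (hC.continuousAt.eventually_ne hC0)
  have hsmall : ∀ᶠ r in 𝓝[>] (0 : ℝ), r ∈ Set.Ioo 0 (min (r₁ / 2) η) :=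
    Ioo_mem_nhdsGT (lt_min (half_pos hr₁) hη)
  obtain ⟨r, hur, hr⟩ := (hu.and hsmall).exists
  obtain ⟨hr', hrη⟩ := lt_min_iff.mp hr.2
  have hnear := ((continuous_quinticPoint s).tendsto 0).eventually
    (quintic.eventually_values_near (quinticPoint s 0) hr.1)
  have hcoeff : ∀ᶠ δ in 𝓝 (0 : ℂ), dist (quinticPoint s δ 0) (-5 * s ^ 4) < r := by
    have h0 : quinticPoint s 0 0 = -5 * s ^ 4 := by simp [quinticPoint]
    rw [← h0]
    exact (((continuous_apply 0).comp (continuous_quinticPoint s)).tendsto 0).eventually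
      (Metric.ball_mem_nhds _ hr.1)
  obtain ⟨ρ, hρ, hball⟩ := Metric.eventually_nhds_iff_ball.mp (hnear.and hcoeff)
  refine ⟨min ρ η, lt_min hρ hη, fun δ hδ hδn hδ1 v hv hv0 => ?_⟩
  have hδρ : ∀ t, δ t ∈ Metric.ball (0 : ℂ) ρ := fun t =>
    mem_ball_zero_iff.mpr ((hδn t).trans_le (min_le_left _ _))
  have hvn : ∀ t, ∃ c ∈ W, dist (v t) c < r := fun t => (hball _ (hδρ t)).1 _ (hv.2 t)
  obtain ⟨c, hc, hc0⟩ := hvn 0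
  have hvc := dist_lt_of_separated hv.1 (fun c hc c' hc' hne => by
    have := hiso c hc c' hc' hne.symm
    linarith) hvn hc hc0
  have hcs : c ≠ s := by
    intro hcs
    rw [hcs] at hc0
    refine (mul_eq_zero.mp (mem_values_quinticPoint.mp (hv.2 0))).elim
      (sub_ne_zero.mpr hv0) (hCη (δ 0, v 0) ?_)
    rw [Metric.mem_ball, Prod.dist_eq, sup_lt_iff]
    exact ⟨by simpa using (hδn 0).trans_le (min_le_right _ _), hc0.trans hrη⟩
  -- Both ends of the lift are roots of the same equation near the simple root c, hence equal.
  refine hur c hc hcs _ _ _ (hball _ (hδρ 0)).2 (hvc 1) (hvc 0) ?_ (hv.2 0)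
  have : v 1 ∈ quintic.values (quinticPoint s (δ 1)) := hv.2 1
  rwa [hδ1] at this

/-- Small s ≠ 0 gives a point of the discriminant curve in the ball where only the root s is
multiple. As δ turns once around 0, the roots s ± √δ change places and the other three return. -/
theorem quintic_exists_swap {ε : ℝ} (hε : 0 < ε) [∀ x : quintic.regularIn (Metric.ball 0 ε),
      DecidableEq (quintic.projOver (quintic.regularIn (Metric.ball 0 ε)) ⁻¹' {x})] :
    ∃ x : quintic.regularIn (Metric.ball 0 ε),
      ∃ s ∈ (quintic.monodromyHom (quintic.regularIn_subset _) x).range, s.IsSwap := by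
  obtain ⟨s, hs0, hs⟩ : ∃ s : ℂ, quinticPoint s 0 ∈ Metric.ball 0 ε ∧ s ≠ 0 := by
    have hc : Continuous fun s => quinticPoint s 0 := by
      refine continuous_pi fun i => ?_
      fin_cases i <;> simp only [quinticPoint] <;> fun_prop
    have h0 : quinticPoint 0 0 ∈ Metric.ball 0 ε := by
      have : quinticPoint 0 0 = 0 := by
        ext i
        fin_cases i <;> simp [quinticPoint]
      rw [this]
      exact Metric.mem_ball_self hε
    have h1 : ∀ᶠ s in 𝓝[≠] (0 : ℂ), quinticPoint s 0 ∈ Metric.ball 0 ε :=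
      nhdsWithin_le_nhds (hc.continuousAt.eventually_mem (Metric.isOpen_ball.mem_nhds h0))
    exact (h1.and self_mem_nhdsWithin).exists
  obtain ⟨r, hr, hclosed⟩ := quintic_exists_radius hs
  have h1 : ∀ᶠ δ in 𝓝[≠] (0 : ℂ), quinticPoint s δ ∈ Metric.ball 0 ε := nhdsWithin_le_nhds
    ((continuous_quinticPoint s).continuousAt.eventually_mem (Metric.isOpen_ball.mem_nhds hs0))
  obtain ⟨ρ, hρ, hball⟩ := Metric.mem_nhdsWithin_iff.mp
    (h1.and (eventually_quinticPoint_mem_regularSet hs))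
  let κ : ℝ := √(min r ρ / 2)
  have hm : 0 < min r ρ := lt_min hr hρ
  have hκ : κ ^ 2 = min r ρ / 2 := Real.sq_sqrt (by positivity)
  have hκ0 : κ ≠ 0 := (Real.sqrt_pos.mpr (by positivity)).ne'
  -- A half turn of the square root μ, from κ to -κ, so that δ = μ² makes a full turn.
  let μ : I → ℂ := fun t => κ * Complex.exp (t * (Real.pi * Complex.I))
  have hμ : Continuous μ := by fun_prop
  have hμn : ∀ t, ‖μ t ^ 2‖ = min r ρ / 2 := by
    intro t
    rw [norm_pow, norm_mul, Complex.norm_real, Complex.norm_exp, mul_pow, Real.norm_eq_abs, sq_abs,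
      hκ]
    simp
  have hμ0 : μ 0 = κ := by simp [μ]
  have hμ1 : μ 1 = -κ := by simp [μ]
  have hmem : ∀ t, quinticPoint s (μ t ^ 2) ∈ quintic.regularIn (Metric.ball 0 ε) := fun t =>
    hball ⟨mem_ball_zero_iff.mpr (by
      rw [hμn]
      linarith [min_le_right r ρ]), by
      rw [Set.mem_compl_singleton_iff, ← norm_ne_zero_iff, hμn]
      positivity⟩
  let x : quintic.regularIn (Metric.ball 0 ε) := ⟨quinticPoint s (μ 0 ^ 2), hmem 0⟩
  let γ : Path x x := ⟨⟨fun t => ⟨quinticPoint s (μ t ^ 2), hmem t⟩, by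
    have := continuous_quinticPoint s
    fun_prop⟩, rfl, Subtype.ext (by simp [x, hμ0, hμ1])⟩
  have hadd : quintic.IsLift (fun t => (γ t).1) fun t => s + μ t :=
    ⟨by fun_prop, fun t => mem_values_quinticPoint.mpr (by ring)⟩
  have hsub : quintic.IsLift (fun t => (γ t).1) fun t => s - μ t :=
    ⟨by fun_prop, fun t => mem_values_quinticPoint.mpr (by ring)⟩
  let e₁ : quintic.projOver (quintic.regularIn (Metric.ball 0 ε)) ⁻¹' {x} :=
    fiberMk x (v := s + μ 0) (hadd.2 0)
  let e₂ : quintic.projOver (quintic.regularIn (Metric.ball 0 ε)) ⁻¹' {x} :=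
    fiberMk x (v := s - μ 0) (hsub.2 0)
  refine ⟨x, _, ⟨loopClass γ, rfl⟩, e₁, e₂, fun h => ?_, ?_⟩
  · have h2 : s + μ 0 = s - μ 0 := congrArg fiberVal h
    have h3 : (κ : ℂ) = 0 := by
      rw [hμ0] at h2
      linear_combination (1 / 2 : ℂ) * h2
    exact hκ0 (by exact_mod_cast h3)
  · ext1 e
    refine fiberVal_injective ?_
    by_cases he₁ : e = e₁
    · subst he₁
      rw [Equiv.swap_apply_left, fiberVal_monodromyHom _ γ hadd e₁ rfl]
      simp [e₂, hμ0, hμ1, sub_eq_add_neg]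
    by_cases he₂ : e = e₂
    · subst he₂
      rw [Equiv.swap_apply_right, fiberVal_monodromyHom _ γ hsub e₂ rfl]
      simp [e₁, hμ0, hμ1]
    rw [Equiv.swap_apply_of_ne_of_ne he₁ he₂]
    have he : fiberVal e ∈ quintic.values (γ 0).1 := by
      rw [γ.source]
      exact fiberVal_mem e
    obtain ⟨v, hv, hv0⟩ := exists_isLift_of_path (quintic.regularIn_subset _)
      (γ : C(I, quintic.regularIn (Metric.ball 0 ε))) he
    rw [fiberVal_monodromyHom _ γ hv e hv0, ← hv0]
    refine hclosed (fun t => μ t ^ 2) (by fun_prop) (fun t => ?_) (by simp [hμ0, hμ1]) v hv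
      fun h => ?_
    · rw [hμn]
      linarith [min_le_left r ρ]
    · rw [hv0] at h
      rcases sq_eq_sq_iff_eq_or_eq_neg.mp h with h | h
      · exact he₁ (fiberVal_injective (by simp [e₁, ← h]))
      · exact he₂ (fiberVal_injective (by simp [e₂, sub_eq_add_neg, ← h]))

/-- The 5-cycle and the transposition are found at different base points and are conjugated to `x₀`.
Transitivity makes 5 divide the order of the group, and for prime degree a transposition then forces
the full symmetric group. -/
theorem quintic_hasFullSymmetricLocalMonodromy : quintic.HasFullSymmetricLocalMonodromyAt 0 5 := by
  classical
  filter_upwards [self_mem_nhdsWithin] with ε hε x₀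
  let U : Set (Fin 2 → ℂ) := Metric.ball 0 ε
  change Nat.card (quintic.projOver (quintic.regularIn U) ⁻¹' {x₀}) = 5 ∧
    (quintic.monodromyHom (quintic.regularIn_subset U) x₀).range = ⊤
  have hcard : Nat.card (quintic.projOver (quintic.regularIn U) ⁻¹' {x₀}) = 5 := by
    rw [Nat.card_congr (fiberEquiv quintic x₀), quintic.card_values x₀.2.2]
    exact quinticEqn_natDegree
  refine ⟨hcard, ?_⟩
  have : Finite (quintic.projOver (quintic.regularIn U) ⁻¹' {x₀}) :=
    Nat.finite_of_card_ne_zero (by rw [hcard]; norm_num)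
  have := Fintype.ofFinite (quintic.projOver (quintic.regularIn U) ⁻¹' {x₀})
  have hjoin : ∀ x : quintic.regularIn U, Joined x x₀ := fun x =>
    joined_nonvanishing (D := quintic.eqn.discr) Metric.isOpen_ball (convex_ball 0 ε) x x₀
  obtain ⟨x₁, h₁⟩ := quintic_exists_transitive hε
  obtain ⟨x₂, s, hs, e₁, e₂, hne, rfl⟩ := quintic_exists_swap hε
  obtain ⟨f₁, hf₁⟩ := exists_conj_monodromyHom (quintic.regularIn_subset U) (hjoin x₁)
  obtain ⟨f₂, hf₂⟩ := exists_conj_monodromyHom (quintic.regularIn_subset U) (hjoin x₂)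
  set Γ := (quintic.monodromyHom (quintic.regularIn_subset U) x₀).range
  rw [Nat.card_eq_fintype_card] at hcard
  have htrans : MulAction.IsPretransitive Γ (quintic.projOver (quintic.regularIn U) ⁻¹' {x₀}) := by
    refine ⟨fun e e' => ?_⟩
    obtain ⟨t, ht, hte⟩ := h₁ (f₁.symm e) (f₁.symm e')
    refine ⟨⟨_, hf₁ t ht⟩, ?_⟩
    change f₁.permCongr t e = e'
    rw [Equiv.permCongr_apply, hte, Equiv.apply_symm_apply]
  have := Fintype.ofFinite Γ
  have hdvd : Fintype.card (quintic.projOver (quintic.regularIn U) ⁻¹' {x₀}) ∣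
      Fintype.card Γ := by
    obtain ⟨e⟩ : Nonempty (quintic.projOver (quintic.regularIn U) ⁻¹' {x₀}) :=
      Fintype.card_pos_iff.mp (by rw [hcard]; norm_num)
    rw [← Nat.card_eq_fintype_card, ← Nat.card_eq_fintype_card,
      ← MulAction.index_stabilizer_of_transitive Γ e]
    exact Subgroup.index_dvd_card _
  refine Equiv.Perm.subgroup_eq_top_of_swap_mem (by rw [hcard]; norm_num)
    (by convert hdvd) (hf₂ _ hs) ⟨f₂ e₁, f₂ e₂, f₂.injective.ne hne, ?_⟩
  ext1 e
  rw [Equiv.permCongr_apply]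
  simp [Equiv.swap_apply_def, Equiv.symm_apply_eq, apply_ite f₂]

theorem IsExpressible.mono {N : ℕ} {B B' : (k : ℕ) → EntireAlgFun k → Prop}
    (h : ∀ k Φ, B k Φ → B' k Φ) {y : EntireAlgFun N} (hy : IsExpressible B y) :
    IsExpressible B' y := by
  induction hy with
  | coord i => exact .coord i
  | comp Φ G H hΦ hG hH ih => exact .comp Φ G H (h _ _ hΦ) ih hH

theorem not_isExpressible_quintic : ¬ IsExpressible IsSumOrProductOrOneVariable quintic := by
  intro h
  have h1 : IsExpressible IsPolynomialOrOneVariable quintic := h.mono fun k Φ hΦ => by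
    cases hΦ with
    | sum => exact .polynomial _
    | product => exact .polynomial _
    | oneVariable f => exact .oneVariable f
  obtain ⟨ε, ⟨hsol, hfull⟩, hε⟩ := ((((h1.solvableNear 0).hasSolvableLocalMonodromyAt).and
    quintic_hasFullSymmetricLocalMonodromy).and self_mem_nhdsWithin).exists
  obtain ⟨x, hx⟩ := exists_eval_ne_zero (U := Metric.ball 0 ε) Metric.isOpen_ball
    (Metric.nonempty_ball.mpr hε) quintic.discr_ne_zero
  have hs := hsol ⟨x, hx⟩
  obtain ⟨hcard, htop⟩ := hfull ⟨x, hx⟩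
  rw [htop] at hs
  have := Group.isSolvable_of_surjective (f := Subgroup.subtype
    (⊤ : Subgroup (Equiv.Perm (quintic.projIn (Metric.ball 0 ε) ⁻¹' {⟨x, hx⟩}))))
    fun g => ⟨⟨g, trivial⟩, rfl⟩
  refine Equiv.Perm.not_isSolvable _ ?_ this
  have := Nat.finite_of_card_ne_zero (hcard.trans_ne (by norm_num))
  rw [← Nat.cast_card, hcard]
  norm_num

end EntireAlgFun

theorem theorem2p18 :
    (∀ (N : ℕ) (y : EntireAlgFun N), EntireAlgFun.IsExpressible EntireAlgFun.IsPolynomialOrOneVariable y →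
      ∀ p : Fin N → ℂ, y.HasSolvableLocalMonodromyAt p) ∧
    EntireAlgFun.quintic.HasFullSymmetricLocalMonodromyAt 0 5 ∧
    ¬ EntireAlgFun.IsExpressible EntireAlgFun.IsSumOrProductOrOneVariable EntireAlgFun.quintic :=
  ⟨fun _ _ hy p => (hy.solvableNear p).hasSolvableLocalMonodromyAt,
    EntireAlgFun.quintic_hasFullSymmetricLocalMonodromy, EntireAlgFun.not_isExpressible_quintic⟩
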